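/- **Theorem (Crude monoidal monadicity).** Let $\mathcal C$ and $\mathcal D$ be monoidal categories that have coequalizers of reflexive pairs, and suppose that in both of them these are preserved by $\otimes$ in each variable. Let $G\dashv R$ be a monoidal adjunction, i.e. $G\colon\mathcal C\to\mathcal D$ and $R\colon\mathcal D\to\mathcal C$ are lax monoidal functors, $G$ is left adjoint to $R$, and the unit $\eta$ and the counit are monoidal transformations. Assume that 1. $R$ preserves coequalizers of reflexive pairs; 2. $R$ reflects isomorphisms; 3. the projection formula holds for $R$: for all $A\in\mathcal C$ and $X\in\mathcal D$ the morphisms $$\mathrm{lproj}_{A,X}\colon A\otimes R(X)\xrightarrow{\eta_A\otimes \mathrm{id}}RG(A)\otimes R(X)\xrightarrow{\mathrm{lax}}R(G(A)\otimes X),$$ $$\mathrm{rproj}_{X,A}\colon R(X)\otimes A\xrightarrow{\mathrm{id}\otimes\eta_A}R(X)\otimes RG(A)\xrightarrow{\mathrm{lax}}R(X\otimes G(A))$$ are isomorphisms. Then $M:=R(\mathbb 1)$, with the multiplication and unit given by the lax structure of $R$ and the half-braiding $$\mathrm{swap}_A\colon M\otimes A\xrightarrow{\mathrm{rproj}_{\mathbb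 1,A}}R(\mathbb 1\otimes G(A))\cong R(G(A)\otimes\mathbb 1)\xrightarrow{\mathrm{lproj}_{A,\mathbb 1}^{-1}}A\otimes M,$$ is a commutative monoid in the Drinfeld center of $\mathcal C$. Let $\mathrm{Mod}_{\mathcal C}(M)$ be the category of right $M$-modules in $\mathcal C$ (the Eilenberg–Moore category of the monad $(-)\otimes M$), with the monoidal structure with unit $M$ and tensor product $X\otimes_M Y$, the coequalizer of the reflexive pair $$\mathrm{act}_X\otimes \mathrm{id}_Y,\ \ \mathrm{id}_X\otimes(\mathrm{act}_Y\circ\mathrm{swap}_Y)\colon\ X\otimes M\otimes Y\rightrightarrows X\otimes Y.$$ The forgetful functor $\mathrm{Forg}$ is lax monoidal via the quotient maps $X\otimes Y\to X\otimes_M Y$ and the unit $\mathbb 1\to M$. The free functor $\mathrm{Free}(A)=A\otimes M$ is monoidal via the factorization through $\otimes_M$ of $A\otimes M\otimes B\otimes M\xrightarrow{\mathrm{id}\otimes\mathrm{swap}_B\otimes\mathrm{id}}A\otimes B\otimes M\otimes M\xrightarrow{\mathrm{id}\otimes\mathrm{mult}}A\otimes B\otimes M$. These form a monoidal adjunction $\mathrm{Free}\dashv\mathrm{Forg}\colon\mathcal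 C\rightleftarrows\mathrm{Mod}_{\mathcal C}(M)$, and: * $G\dashv R$ is equivalent to $\mathrm{Free}\dashv\mathrm{Forg}$ as a monoidal adjunction, i.e. the two are equivalent objects of the following bicategory. Objects are monoidal adjunctions. A $1$-morphism from $G\dashv R$ to $G'\dashv R'$ consists of lax monoidal functors $U,V$ between the sources and the targets of the left adjoints and monoidal transformations $\alpha\colon G'U\to VG$, $\beta\colon UR\to R'V$ that are mates, i.e. $R'\alpha\circ\eta'U=\beta G\circ U\eta$; composition is by pasting. A $2$-morphism $(U_1,V_1,\alpha_1,\beta_1)\to(U_2,V_2,\alpha_2,\beta_2)$ is a pair of monoidal transformations $\tau\colon U_1\to U_2$, $\sigma\colon V_1\to V_2$ with $\alpha_2\circ G'\tau=\sigma G\circ\alpha_1$ and $\beta_2\circ\tau R=R'\sigma\circ\beta_1$. * In particular $G\dashv R$ is monadic: the comparison functor from $\mathcal D$ to the Eilenberg–Moore category of the monad $RG$ is an equivalence of categories. -/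

import Mathlib

open CategoryTheory MonoidalCategory Limits

universe v₁ v₂ v₃ v₄ v₅ v₆ u₁ u₂ u₃ u₄ u₅ u₆

noncomputable section

/-- The tensor product preserves coequalizers of reflexive pairs in each variable. -/
class TensorPreservesReflexiveCoequalizers (C : Type u₁) [Category.{v₁} C]
    [MonoidalCategory C] : Prop where
  left (A : C) : Monad.PreservesColimitOfIsReflexivePair (tensorLeft A)
  right (A : C) : Monad.PreservesColimitOfIsReflexivePair (tensorRight A)

/-- A commutative central monoid: a commutative monoid internal to the Drinfeld center,
with its half-braiding `swap : M ⊗ A ≅ A ⊗ M`. -/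
structure CommCentralMonoid (C : Type u₁) [Category.{v₁} C] [MonoidalCategory C] where
  X : C
  one : 𝟙_ C ⟶ X
  mul : X ⊗ X ⟶ X
  one_mul : one ▷ X ≫ mul = (λ_ X).hom
  mul_one : X ◁ one ≫ mul = (ρ_ X).hom
  mul_assoc : mul ▷ X ≫ mul = (α_ X X X).hom ≫ X ◁ mul ≫ mul
  halfBraiding : HalfBraiding X
  one_swap (A : C) : one ▷ A ≫ (halfBraiding.β A).hom = (λ_ A).hom ≫ (ρ_ A).inv ≫ A ◁ one
  mul_swap (A : C) : mul ▷ A ≫ (halfBraiding.β A).hom =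
    (α_ X X A).hom ≫ X ◁ (halfBraiding.β A).hom ≫ (α_ X A X).inv ≫
      (halfBraiding.β A).hom ▷ X ≫ (α_ A X X).hom ≫ A ◁ mul
  swap_mul : (halfBraiding.β X).hom ≫ mul = mul

namespace CommCentralMonoid

variable {C : Type u₁} [Category.{v₁} C] [MonoidalCategory C] (M : CommCentralMonoid C)

/-- The half-braiding `M ⊗ A ⟶ A ⊗ M`. -/
def swap (A : C) : M.X ⊗ A ⟶ A ⊗ M.X := (M.halfBraiding.β A).hom

lemma swap_naturality {A B : C} (f : A ⟶ B) :
    M.X ◁ f ≫ M.swap B = M.swap A ≫ f ▷ M.X := M.halfBraiding.naturality f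

lemma swap_tensor (A B : C) : M.swap (A ⊗ B) = (α_ _ _ _).inv ≫ M.swap A ▷ B ≫
    (α_ _ _ _).hom ≫ A ◁ M.swap B ≫ (α_ _ _ _).inv := M.halfBraiding.monoidal A B

lemma one_whisker_swap (A : C) :
    M.one ▷ A ≫ M.swap A = (λ_ A).hom ≫ (ρ_ A).inv ≫ A ◁ M.one := M.one_swap A

lemma mul_whisker_swap (A : C) : M.mul ▷ A ≫ M.swap A =
    (α_ _ _ _).hom ≫ M.X ◁ M.swap A ≫ (α_ _ _ _).inv ≫ M.swap A ▷ M.X ≫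
      (α_ _ _ _).hom ≫ A ◁ M.mul := M.mul_swap A

lemma swap_comp_mul : M.swap M.X ≫ M.mul = M.mul := M.swap_mul

/-- The monad `(-) ⊗ M`. -/
def monad : Monad C where
  toFunctor := tensorRight M.X
  η := { app := fun A => (ρ_ A).inv ≫ A ◁ M.one
         naturality := fun A B f => by
          simp [whisker_exchange] }
  μ := { app := fun A => (α_ A M.X M.X).hom ≫ A ◁ M.mul
         naturality := fun A B f => by
          simp [whisker_exchange] }
  assoc A := by
    have h := M.mul_assoc
    calc _ = (α_ _ _ _).hom ▷ M.X ≫ (α_ _ _ _).hom ≫ A ◁ (M.mul ▷ M.X ≫ M.mul) := by simp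
      _ = _ := by rw [h]; simp
  left_unit A := by
    calc _ = (ρ_ _).inv ≫ (α_ _ _ _).hom ≫ A ◁ (M.X ◁ M.one ≫ M.mul) := by simp
      _ = _ := by rw [M.mul_one]; simp
  right_unit A := by
    calc _ = A ◁ (λ_ _).inv ≫ A ◁ (M.one ▷ M.X ≫ M.mul) := by simp
      _ = _ := by rw [M.one_mul, ← whiskerLeft_comp]; simp

/-- The Eilenberg-Moore category of `(-) ⊗ M`: right `M`-modules in `C`. -/
abbrev EM := M.monad.Algebra

variable {M}

/-- The action `A ⊗ M ⟶ A`. -/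
def act (X : M.EM) : X.A ⊗ M.X ⟶ X.A := X.a

lemma one_act (X : M.EM) : X.A ◁ M.one ≫ act X = (ρ_ X.A).hom := by
  have h : ((ρ_ X.A).inv ≫ X.A ◁ M.one) ≫ act X = 𝟙 _ := X.unit
  rwa [Category.assoc, Iso.inv_comp_eq, Category.comp_id] at h

lemma act_act (X : M.EM) : act X ▷ M.X ≫ act X =
    (α_ _ _ _).hom ≫ X.A ◁ M.mul ≫ act X := by
  have h : ((α_ _ _ _).hom ≫ X.A ◁ M.mul) ≫ act X = act X ▷ M.X ≫ act X := X.assoc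
  rw [← h, Category.assoc]

lemma act_hom {X Y : M.EM} (f : X ⟶ Y) : f.f ▷ M.X ≫ act Y = act X ≫ f.f := f.h

/-- The induced left action `M ⊗ A ⟶ A`. -/
def lact (X : M.EM) : M.X ⊗ X.A ⟶ X.A := M.swap X.A ≫ act X

lemma one_lact (X : M.EM) : M.one ▷ X.A ≫ lact X = (λ_ X.A).hom := by
  simp [lact, reassoc_of% M.one_whisker_swap, one_act]

lemma lact_act (X : M.EM) : lact X ▷ M.X ≫ act X = (α_ _ _ _).hom ≫ M.X ◁ act X ≫ lact X := by
  have h : X.A ◁ M.swap M.X ≫ X.A ◁ M.mul = X.A ◁ M.mul := by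
    rw [← whiskerLeft_comp, swap_comp_mul]
  simp [lact, act_act, reassoc_of% M.swap_naturality (act X), swap_tensor, reassoc_of% h]

lemma mul_lact (X : M.EM) : M.mul ▷ X.A ≫ lact X = (α_ _ _ _).hom ≫ M.X ◁ lact X ≫ lact X := by
  have h : M.X ◁ act X ≫ lact X = (α_ _ _ _).inv ≫ lact X ▷ M.X ≫ act X := by
    simp [lact_act]
  nth_rw 2 [lact]
  simp only [whiskerLeft_comp, Category.assoc, h]
  simp [lact, act_act, reassoc_of% M.mul_whisker_swap]

lemma lact_hom {X Y : M.EM} (f : X ⟶ Y) : M.X ◁ f.f ≫ lact Y = lact X ≫ f.f := by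
  simp [lact, reassoc_of% M.swap_naturality f.f, act_hom]

/-- Construct a module from an object and an action. -/
abbrev mkEM (A : C) (a : A ⊗ M.X ⟶ A) (h₁ : A ◁ M.one ≫ a = (ρ_ A).hom)
    (h₂ : a ▷ M.X ≫ a = (α_ _ _ _).hom ≫ A ◁ M.mul ≫ a) : M.EM where
  A := A
  a := a
  unit := by
    change ((ρ_ A).inv ≫ A ◁ M.one) ≫ a = 𝟙 _
    simp [h₁]
  assoc := by
    change ((α_ _ _ _).hom ≫ A ◁ M.mul) ≫ a = a ▷ M.X ≫ a
    simp [h₂]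

/-- Construct a morphism of modules. -/
def homEM {X Y : M.EM} (f : X.A ⟶ Y.A) (h : f ▷ M.X ≫ act Y = act X ≫ f) : X ⟶ Y where
  f := f
  h := h

variable (M) in
/-- The monoid `M` as a module over itself; this is the monoidal unit. -/
abbrev unitEM : M.EM := mkEM M.X M.mul M.mul_one M.mul_assoc

lemma lact_unit : lact M.unitEM = M.mul := M.swap_comp_mul

lemma lact_balanced (X : M.EM) : act M.unitEM ▷ X.A ≫ lact X =
    (α_ _ _ _).hom ≫ M.unitEM.A ◁ lact X ≫ lact X := mul_lact X

lemma act_balanced (X : M.EM) : act X ▷ M.unitEM.A ≫ act X =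
    (α_ _ _ _).hom ≫ X.A ◁ lact M.unitEM ≫ act X := by
  rw [lact_unit]; exact act_act X

variable (M) in
/-- The free module `A ⊗ M`. -/
abbrev fr (A : C) : M.EM := mkEM (A ⊗ M.X) ((α_ _ _ _).hom ≫ A ◁ M.mul)
  (by
    have h := congr(A ◁ $(M.mul_one))
    simp only [whiskerLeft_comp] at h
    simp [h])
  (by
    have h := congr(A ◁ $(M.mul_assoc))
    simp only [whiskerLeft_comp] at h
    simp [h])

lemma act_fr (A : C) : act (M.fr A) = (α_ _ _ _).hom ≫ A ◁ M.mul := rfl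

variable (M) in
/-- The unit `A ⟶ A ⊗ M`. -/
def un (A : C) : A ⟶ (M.fr A).A := (ρ_ A).inv ≫ A ◁ M.one

lemma un_act (A : C) : M.un A ▷ M.X ≫ act (M.fr A) = 𝟙 (A ⊗ M.X) := by
  have h := congr(A ◁ $(M.one_mul))
  simp only [whiskerLeft_comp] at h
  simp [un, act_fr, h]

variable (M) in
/-- The lax structure `(A ⊗ M) ⊗ (B ⊗ M) ⟶ (A ⊗ B) ⊗ M` of the monoidal monad `(-) ⊗ M`. -/
def laxT (A B : C) : (A ⊗ M.X) ⊗ (B ⊗ M.X) ⟶ (A ⊗ B) ⊗ M.X :=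
  (α_ _ _ _).hom ≫ A ◁ ((α_ _ _ _).inv ≫ M.swap B ▷ M.X ≫ (α_ _ _ _).hom ≫ B ◁ M.mul) ≫
    (α_ _ _ _).inv

lemma lact_fr (B : C) : lact (M.fr B) =
    (α_ _ _ _).inv ≫ M.swap B ▷ M.X ≫ (α_ _ _ _).hom ≫ B ◁ M.mul := by
  have h := congr(B ◁ $(M.swap_comp_mul))
  simp only [whiskerLeft_comp] at h
  simp [lact, act_fr, swap_tensor, h]

lemma laxT_eq (A B : C) : M.laxT A B = (α_ _ _ _).hom ≫ A ◁ lact (M.fr B) ≫ (α_ _ _ _).inv := by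
  rw [lact_fr, laxT]

lemma laxT_balanced (A B : C) : act (M.fr A) ▷ (M.fr B).A ≫ M.laxT A B =
    (α_ _ _ _).hom ≫ (M.fr A).A ◁ lact (M.fr B) ≫ M.laxT A B := by
  have h := congr(A ◁ $(mul_lact (M.fr B)))
  simp only [whiskerLeft_comp] at h
  rw [laxT_eq, act_fr]
  simp [reassoc_of% h, -whiskerRight_tensor]

lemma laxT_act (A B : C) : M.laxT A B ▷ M.X ≫ act (M.fr (A ⊗ B)) =
    (α_ _ _ _).hom ≫ (M.fr A).A ◁ act (M.fr B) ≫ M.laxT A B := by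
  have h := congr(A ◁ $(lact_act (M.fr B)))
  simp only [whiskerLeft_comp] at h
  have e : act (M.fr (A ⊗ B)) = (α_ _ _ _).hom ▷ M.X ≫ (α_ _ _ _).hom ≫
      A ◁ act (M.fr B) ≫ (α_ _ _ _).inv := by
    simp [act_fr]
  rw [laxT_eq, e]
  simp [reassoc_of% h]

lemma un_laxT (A B : C) : (M.un A ⊗ₘ M.un B) ≫ M.laxT A B = M.un (A ⊗ B) := by
  have h := congr(A ◁ $(one_lact (M.fr B)))
  simp only [whiskerLeft_comp] at h
  rw [laxT_eq, tensorHom_def', un]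
  simp [reassoc_of% h, un, -whiskerRight_tensor]

variable (M) in
/-- The forgetful functor to `C`. -/
abbrev forg : M.EM ⥤ C := M.monad.forget

variable (M) in
/-- The free module functor `A ↦ A ⊗ M`. -/
abbrev free : C ⥤ M.EM := M.monad.free

variable (M) in
/-- The free-forgetful adjunction. -/
abbrev freeForg : free M ⊣ forg M := M.monad.adj

lemma freeForg_unit (A : C) : M.freeForg.unit.app A = M.un A := by
  rw [freeForg, Monad.adj_unit]; rfl

lemma freeForg_counit (X : M.EM) : (M.freeForg.counit.app X).f = act X := by
  rw [freeForg, Monad.adj_counit]; rfl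

/-- The counit `A ⊗ M ⟶ A` as a morphism of modules. -/
def coun (X : M.EM) : M.fr X.A ⟶ X := M.freeForg.counit.app X

lemma coun_f (X : M.EM) : (coun X).f = act X := freeForg_counit X

section Tensor

/-- First map `act ⊗ B : (A ⊗ M) ⊗ B ⟶ A ⊗ B`. -/
def relL (X Y : M.EM) : (X.A ⊗ M.X) ⊗ Y.A ⟶ X.A ⊗ Y.A := act X ▷ Y.A

/-- Second map `A ⊗ (act ∘ swap) : (A ⊗ M) ⊗ B ⟶ A ⊗ B`. -/
def relR (X Y : M.EM) : (X.A ⊗ M.X) ⊗ Y.A ⟶ X.A ⊗ Y.A := (α_ _ _ _).hom ≫ X.A ◁ lact Y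

instance (X Y : M.EM) : IsReflexivePair (relL X Y) (relR X Y) :=
  IsReflexivePair.mk' (((ρ_ X.A).inv ≫ X.A ◁ M.one) ▷ Y.A)
    (by rw [relL, ← comp_whiskerRight, Category.assoc, one_act]; simp)
    (by simp [relR, ← whiskerLeft_comp, one_lact])

variable [HasReflexiveCoequalizers C]

/-- The relative tensor product `X ⊗_M Y` as an object of `C`. -/
def tens (X Y : M.EM) : C := coequalizer (relL X Y) (relR X Y)

/-- The quotient map `A ⊗ B ⟶ X ⊗_M Y`. -/
def quo (X Y : M.EM) : X.A ⊗ Y.A ⟶ tens X Y := coequalizer.π _ _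

lemma quo_condition (X Y : M.EM) :
    act X ▷ Y.A ≫ quo X Y = (α_ _ _ _).hom ≫ X.A ◁ lact Y ≫ quo X Y := by
  have h : relL X Y ≫ quo X Y = relR X Y ≫ quo X Y := coequalizer.condition _ _
  simpa [relL, relR] using h

instance (X Y : M.EM) : Epi (quo X Y) := inferInstanceAs (Epi (coequalizer.π _ _))

/-- Descend a balanced map along `quo`. -/
def desc {X Y : M.EM} {Z : C} (h : X.A ⊗ Y.A ⟶ Z)
    (w : act X ▷ Y.A ≫ h = (α_ _ _ _).hom ≫ X.A ◁ lact Y ≫ h) : tens X Y ⟶ Z :=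
  coequalizer.desc h (by simpa [relL, relR] using w)

lemma quo_desc {X Y : M.EM} {Z : C} (h : X.A ⊗ Y.A ⟶ Z)
    (w : act X ▷ Y.A ≫ h = (α_ _ _ _).hom ≫ X.A ◁ lact Y ≫ h) : quo X Y ≫ desc h w = h :=
  coequalizer.π_desc _ _

lemma tensAct_aux (X Y : M.EM) :
    act X ▷ Y.A ▷ M.X ≫ (α_ _ _ _).hom ≫ X.A ◁ act Y ≫ quo X Y =
      ((α_ _ _ _).hom ≫ X.A ◁ lact Y) ▷ M.X ≫ (α_ _ _ _).hom ≫ X.A ◁ act Y ≫ quo X Y := by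
  have h := congr(X.A ◁ $(lact_act Y))
  simp only [whiskerLeft_comp] at h
  rw [associator_naturality_left_assoc, ← whisker_exchange_assoc, quo_condition]
  simp [reassoc_of% h]

variable [TensorPreservesReflexiveCoequalizers C]

/-- `quo ⊗ W` is a coequalizer. -/
def isColimitR (X Y : M.EM) (W : C) :=
  have := TensorPreservesReflexiveCoequalizers.right W
  isColimitOfHasCoequalizerOfPreservesColimit (tensorRight W) (relL X Y) (relR X Y)

/-- `W ⊗ quo` is a coequalizer. -/
def isColimitL (X Y : M.EM) (W : C) :=
  have := TensorPreservesReflexiveCoequalizers.left W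
  isColimitOfHasCoequalizerOfPreservesColimit (tensorLeft W) (relL X Y) (relR X Y)

/-- Descend along `quo ⊗ W`. -/
def descR {X Y : M.EM} {Z W : C} (h : (X.A ⊗ Y.A) ⊗ W ⟶ Z)
    (w : act X ▷ Y.A ▷ W ≫ h = ((α_ _ _ _).hom ≫ X.A ◁ lact Y) ▷ W ≫ h) : tens X Y ⊗ W ⟶ Z :=
  Cofork.IsColimit.desc (isColimitR X Y W) h w

lemma quo_descR {X Y : M.EM} {Z W : C} (h : (X.A ⊗ Y.A) ⊗ W ⟶ Z)
    (w : act X ▷ Y.A ▷ W ≫ h = ((α_ _ _ _).hom ≫ X.A ◁ lact Y) ▷ W ≫ h) :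
    quo X Y ▷ W ≫ descR h w = h :=
  Cofork.IsColimit.π_desc' (isColimitR X Y W) h w

/-- Descend along `W ⊗ quo`. -/
def descL {X Y : M.EM} {Z W : C} (h : W ⊗ (X.A ⊗ Y.A) ⟶ Z)
    (w : W ◁ act X ▷ Y.A ≫ h = W ◁ ((α_ _ _ _).hom ≫ X.A ◁ lact Y) ≫ h) : W ⊗ tens X Y ⟶ Z :=
  Cofork.IsColimit.desc (isColimitL X Y W) h w

lemma quo_descL {X Y : M.EM} {Z W : C} (h : W ⊗ (X.A ⊗ Y.A) ⟶ Z)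
    (w : W ◁ act X ▷ Y.A ≫ h = W ◁ ((α_ _ _ _).hom ≫ X.A ◁ lact Y) ≫ h) :
    W ◁ quo X Y ≫ descL h w = h :=
  Cofork.IsColimit.π_desc' (isColimitL X Y W) h w

instance (X Y : M.EM) (W : C) : Epi (quo X Y ▷ W) :=
  epi_of_isColimit_cofork (isColimitR X Y W)

instance (X Y : M.EM) (W : C) : Epi (W ◁ quo X Y) :=
  epi_of_isColimit_cofork (isColimitL X Y W)

instance (X Y : M.EM) (W Z : C) : Epi (quo X Y ▷ W ▷ Z) := by
  have : quo X Y ▷ W ▷ Z = (α_ _ _ _).hom ≫ quo X Y ▷ (W ⊗ Z) ≫ (α_ _ _ _).inv := by simp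
  rw [this]; infer_instance

instance (X Y : M.EM) (W Z : C) : Epi (W ◁ Z ◁ quo X Y) := by
  have : W ◁ Z ◁ quo X Y = (α_ _ _ _).inv ≫ (W ⊗ Z) ◁ quo X Y ≫ (α_ _ _ _).hom := by simp
  rw [this]; infer_instance

/-- The action of `M` on `X ⊗_M Y`. -/
def tensAct (X Y : M.EM) : tens X Y ⊗ M.X ⟶ tens X Y :=
  descR ((α_ _ _ _).hom ≫ X.A ◁ act Y ≫ quo X Y) (tensAct_aux X Y)

lemma quo_tensAct (X Y : M.EM) :
    quo X Y ▷ M.X ≫ tensAct X Y = (α_ _ _ _).hom ≫ X.A ◁ act Y ≫ quo X Y := quo_descR _ _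

/-- The relative tensor product as a module. -/
def tensEM (X Y : M.EM) : M.EM :=
  mkEM (tens X Y) (tensAct X Y)
    (by
      have h := congr(X.A ◁ $(one_act Y))
      simp only [whiskerLeft_comp] at h
      rw [← cancel_epi (quo X Y ▷ 𝟙_ C), ← whisker_exchange_assoc, quo_tensAct]
      simp [reassoc_of% h])
    (by
      have h := congr(X.A ◁ $(act_act Y))
      simp only [whiskerLeft_comp] at h
      rw [← cancel_epi (quo X Y ▷ M.X ▷ M.X), ← comp_whiskerRight_assoc, quo_tensAct,
        associator_naturality_left_assoc, ← whisker_exchange_assoc, quo_tensAct]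
      simp only [comp_whiskerRight, Category.assoc, quo_tensAct]
      simp [reassoc_of% h])

/-- The quotient map `quo : A ⊗ B ⟶ X ⊗_M Y` into the object underlying the module `X ⊗_M Y`. -/
def π (X Y : M.EM) : X.A ⊗ Y.A ⟶ (tensEM X Y).A := quo X Y

lemma π_condition (X Y : M.EM) :
    act X ▷ Y.A ≫ π X Y = (α_ _ _ _).hom ≫ X.A ◁ lact Y ≫ π X Y := quo_condition X Y

lemma π_act (X Y : M.EM) :
    π X Y ▷ M.X ≫ act (tensEM X Y) = (α_ _ _ _).hom ≫ X.A ◁ act Y ≫ π X Y := quo_tensAct X Y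

instance (X Y : M.EM) : Epi (π X Y) := inferInstanceAs (Epi (quo X Y))
instance (X Y : M.EM) (W : C) : Epi (π X Y ▷ W) := inferInstanceAs (Epi (quo X Y ▷ W))
instance (X Y : M.EM) (W : C) : Epi (W ◁ π X Y) := inferInstanceAs (Epi (W ◁ quo X Y))
instance (X Y : M.EM) (W Z : C) : Epi (π X Y ▷ W ▷ Z) :=
  inferInstanceAs (Epi (quo X Y ▷ W ▷ Z))

lemma π_lact (X Y : M.EM) :
    M.X ◁ π X Y ≫ lact (tensEM X Y) = (α_ _ _ _).inv ≫ lact X ▷ Y.A ≫ π X Y := by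
  have h := π_condition X Y
  rw [lact, reassoc_of% M.swap_naturality, π_act, swap_tensor]
  simp only [lact, comp_whiskerRight, Category.assoc, h]
  simp

/-- Descend a balanced map to the tensor product. -/
def πdesc {X Y : M.EM} {Z : C} (h : X.A ⊗ Y.A ⟶ Z)
    (w : act X ▷ Y.A ≫ h = (α_ _ _ _).hom ≫ X.A ◁ lact Y ≫ h) : (tensEM X Y).A ⟶ Z :=
  desc h w

lemma π_πdesc {X Y : M.EM} {Z : C} (h : X.A ⊗ Y.A ⟶ Z)
    (w : act X ▷ Y.A ≫ h = (α_ _ _ _).hom ≫ X.A ◁ lact Y ≫ h) : π X Y ≫ πdesc h w = h :=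
  quo_desc h w

lemma tensHom_aux {X X' Y Y' : M.EM} (f : X ⟶ X') (g : Y ⟶ Y') :
    act X ▷ Y.A ≫ (f.f ⊗ₘ g.f) ≫ π X' Y' =
      (α_ _ _ _).hom ≫ X.A ◁ lact Y ≫ (f.f ⊗ₘ g.f) ≫ π X' Y' := by
  have h := π_condition X' Y'
  have h₁ := lact_hom g
  calc _ = (act X ≫ f.f) ▷ Y.A ≫ X'.A ◁ g.f ≫ π X' Y' := by simp [MonoidalCategory.tensorHom_def]
    _ = f.f ▷ M.X ▷ Y.A ≫ (X'.A ⊗ M.X) ◁ g.f ≫ act X' ▷ Y'.A ≫ π X' Y' := by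
      rw [← act_hom, comp_whiskerRight_assoc, whisker_exchange_assoc]
    _ = (f.f ▷ M.X) ▷ Y.A ≫ (α_ _ _ _).hom ≫ X'.A ◁ (M.X ◁ g.f ≫ lact Y') ≫ π X' Y' := by
      rw [h]; simp
    _ = _ := by
      rw [h₁]; simp [MonoidalCategory.tensorHom_def, whisker_exchange_assoc]

/-- The tensor product of morphisms. -/
def tensHom {X X' Y Y' : M.EM} (f : X ⟶ X') (g : Y ⟶ Y') : tensEM X Y ⟶ tensEM X' Y' :=
  homEM (πdesc ((f.f ⊗ₘ g.f) ≫ π X' Y') (tensHom_aux f g))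
    (by
      have h := act_hom g
      rw [← cancel_epi (π X Y ▷ M.X), ← comp_whiskerRight_assoc, π_πdesc, reassoc_of% π_act X Y,
        π_πdesc, comp_whiskerRight_assoc, π_act]
      calc _ = (α_ _ _ _).hom ≫ f.f ▷ _ ≫ X'.A ◁ (g.f ▷ M.X ≫ act Y') ≫ π X' Y' := by
            simp [MonoidalCategory.tensorHom_def]
        _ = _ := by rw [h]; simp [MonoidalCategory.tensorHom_def, whisker_exchange_assoc])

lemma π_tensHom {X X' Y Y' : M.EM} (f : X ⟶ X') (g : Y ⟶ Y') :
    π X Y ≫ (tensHom f g).f = (f.f ⊗ₘ g.f) ≫ π X' Y' := π_πdesc _ (tensHom_aux f g)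

/-- The left unitor `M ⊗_M X ≅ X` in `C`, induced by the left action. -/
def lunitIso (X : M.EM) : (tensEM M.unitEM X).A ≅ X.A where
  hom := πdesc (lact X) (lact_balanced X)
  inv := (λ_ _).inv ≫ M.one ▷ X.A ≫ π M.unitEM X
  hom_inv_id := by
    have h : M.mul ▷ X.A ≫ π M.unitEM X = _ := π_condition M.unitEM X
    have h' : M.X ◁ lact X ≫ π M.unitEM X = (α_ _ _ _).inv ≫ M.mul ▷ X.A ≫ π M.unitEM X := by
      rw [h]; simp
    have h₁ : M.one ▷ M.X ▷ X.A ≫ M.mul ▷ X.A = (λ_ _).hom ▷ X.A := by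
      rw [← comp_whiskerRight, M.one_mul]
    rw [← cancel_epi (π M.unitEM X), reassoc_of% π_πdesc (X := M.unitEM) (lact X) (lact_balanced X),
      leftUnitor_inv_naturality_assoc, whisker_exchange_assoc, h']
    simp [reassoc_of% h₁]
  inv_hom_id := by
    simp [π_πdesc, one_lact]

/-- The right unitor `X ⊗_M M ≅ X` in `C`, induced by the action. -/
def runitIso (X : M.EM) : (tensEM X M.unitEM).A ≅ X.A where
  hom := πdesc (act X) (act_balanced X)
  inv := (ρ_ _).inv ≫ X.A ◁ M.one ≫ π X M.unitEM
  hom_inv_id := by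
    have h : act X ▷ M.X ≫ π X M.unitEM = _ := π_condition X M.unitEM
    rw [lact_unit] at h
    have h₁ : X.A ◁ M.X ◁ M.one ≫ X.A ◁ M.mul = X.A ◁ (ρ_ _).hom := by
      rw [← whiskerLeft_comp, M.mul_one]
    rw [← cancel_epi (π X M.unitEM), reassoc_of% π_πdesc,
      rightUnitor_inv_naturality_assoc, ← whisker_exchange_assoc]
    erw [h]
    simp [reassoc_of% h₁]
  inv_hom_id := by
    simp [π_πdesc, one_act]

lemma assoc_aux₁ (X Y Z : M.EM) :
    act X ▷ Y.A ▷ Z.A ≫ (α_ _ _ _).hom ≫ X.A ◁ π Y Z ≫ π X (tensEM Y Z) =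
      ((α_ _ _ _).hom ≫ X.A ◁ lact Y) ▷ Z.A ≫ (α_ _ _ _).hom ≫ X.A ◁ π Y Z ≫
        π X (tensEM Y Z) := by
  rw [associator_naturality_left_assoc, ← whisker_exchange_assoc, π_condition]
  calc _ = (α_ _ _ _).hom ≫ (α_ _ _ _).hom ≫ X.A ◁ (M.X ◁ π Y Z ≫ lact (tensEM Y Z)) ≫
        π X (tensEM Y Z) := by simp
    _ = _ := by rw [π_lact]; simp

/-- Auxiliary map for the associator. -/
def assocR (X Y Z : M.EM) : (tensEM X Y).A ⊗ Z.A ⟶ (tensEM X (tensEM Y Z)).A :=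
  descR ((α_ _ _ _).hom ≫ X.A ◁ π Y Z ≫ π X (tensEM Y Z)) (assoc_aux₁ X Y Z)

lemma π_assocR (X Y Z : M.EM) : π X Y ▷ Z.A ≫ assocR X Y Z =
    (α_ _ _ _).hom ≫ X.A ◁ π Y Z ≫ π X (tensEM Y Z) := quo_descR _ _

lemma assocR_balanced (X Y Z : M.EM) : act (tensEM X Y) ▷ Z.A ≫ assocR X Y Z =
    (α_ _ _ _).hom ≫ (tensEM X Y).A ◁ lact Z ≫ assocR X Y Z := by
  have h := congr(X.A ◁ $(π_condition Y Z))
  simp only [whiskerLeft_comp] at h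
  rw [← cancel_epi (π X Y ▷ M.X ▷ Z.A), ← comp_whiskerRight_assoc, π_act,
    associator_naturality_left_assoc, ← whisker_exchange_assoc, π_assocR]
  simp only [comp_whiskerRight, Category.assoc, π_assocR]
  simp [reassoc_of% h]

lemma assoc_aux₂ (X Y Z : M.EM) :
    X.A ◁ act Y ▷ Z.A ≫ (α_ _ _ _).inv ≫ π X Y ▷ Z.A ≫ π (tensEM X Y) Z =
      X.A ◁ ((α_ _ _ _).hom ≫ Y.A ◁ lact Z) ≫ (α_ _ _ _).inv ≫ π X Y ▷ Z.A ≫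
        π (tensEM X Y) Z := by
  have h : X.A ◁ act Y ≫ π X Y = (α_ _ _ _).inv ≫ π X Y ▷ M.X ≫ act (tensEM X Y) := by
    rw [π_act]; simp
  rw [associator_inv_naturality_middle_assoc, ← comp_whiskerRight_assoc, h]
  simp only [comp_whiskerRight, Category.assoc, π_condition, whiskerLeft_comp]
  rw [associator_naturality_left_assoc, ← whisker_exchange_assoc]
  simp

/-- Auxiliary map for the inverse of the associator. -/
def assocL (X Y Z : M.EM) : X.A ⊗ (tensEM Y Z).A ⟶ (tensEM (tensEM X Y) Z).A :=
  descL ((α_ _ _ _).inv ≫ π X Y ▷ Z.A ≫ π (tensEM X Y) Z) (assoc_aux₂ X Y Z)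

lemma π_assocL (X Y Z : M.EM) : X.A ◁ π Y Z ≫ assocL X Y Z =
    (α_ _ _ _).inv ≫ π X Y ▷ Z.A ≫ π (tensEM X Y) Z := quo_descL _ _

lemma assocL_balanced (X Y Z : M.EM) : act X ▷ (tensEM Y Z).A ≫ assocL X Y Z =
    (α_ _ _ _).hom ≫ X.A ◁ lact (tensEM Y Z) ≫ assocL X Y Z := by
  have h := congr($(π_condition X Y) ▷ Z.A)
  simp only [comp_whiskerRight] at h
  have h₁ : X.A ◁ M.X ◁ π Y Z ≫ X.A ◁ lact (tensEM Y Z) = X.A ◁ (α_ _ _ _).inv ≫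
      X.A ◁ lact Y ▷ Z.A ≫ X.A ◁ π Y Z := by
    simp only [← whiskerLeft_comp, π_lact]
  rw [← cancel_epi ((X.A ⊗ M.X) ◁ π Y Z), whisker_exchange_assoc, π_assocL,
    associator_naturality_right_assoc, reassoc_of% h₁, π_assocL,
    associator_inv_naturality_left_assoc, reassoc_of% h]
  simp

/-- The associator on underlying objects. -/
def assocIso (X Y Z : M.EM) : (tensEM (tensEM X Y) Z).A ≅ (tensEM X (tensEM Y Z)).A where
  hom := πdesc (assocR X Y Z) (assocR_balanced X Y Z)
  inv := πdesc (assocL X Y Z) (assocL_balanced X Y Z)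
  hom_inv_id := by
    rw [← cancel_epi (π _ _), ← cancel_epi (π X Y ▷ Z.A), reassoc_of% π_πdesc,
      reassoc_of% π_assocR, π_πdesc, π_assocL]
    simp
  inv_hom_id := by
    rw [← cancel_epi (π _ _), ← cancel_epi (X.A ◁ π Y Z), reassoc_of% π_πdesc,
      reassoc_of% π_assocL, π_πdesc, π_assocR]
    simp

lemma π_assocIso (X Y Z : M.EM) :
    π X Y ▷ Z.A ≫ π (tensEM X Y) Z ≫ (assocIso X Y Z).hom =
      (α_ _ _ _).hom ≫ X.A ◁ π Y Z ≫ π X (tensEM Y Z) := by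
  rw [assocIso, π_πdesc, π_assocR]

/-- Isomorphisms of modules from isomorphisms of underlying objects. -/
def isoEM {X Y : M.EM} (e : X.A ≅ Y.A) (h : e.hom ▷ M.X ≫ act Y = act X ≫ e.hom) : X ≅ Y :=
  Monad.Algebra.isoMk e h

/-- The associator. -/
def assocEM (X Y Z : M.EM) : tensEM (tensEM X Y) Z ≅ tensEM X (tensEM Y Z) :=
  isoEM (assocIso X Y Z) (by
    have h := congr(X.A ◁ $(π_act Y Z))
    simp only [whiskerLeft_comp] at h
    rw [← cancel_epi (π _ _ ▷ M.X), ← cancel_epi (π X Y ▷ Z.A ▷ M.X), reassoc_of% π_act,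
      ← comp_whiskerRight_assoc, ← comp_whiskerRight_assoc, Category.assoc, π_assocIso,
      associator_naturality_left_assoc, ← whisker_exchange_assoc, π_assocIso]
    simp only [comp_whiskerRight, Category.assoc, π_act]
    simp [reassoc_of% h])

/-- The left unitor. -/
def lunitEM (X : M.EM) : tensEM M.unitEM X ≅ X :=
  isoEM (lunitIso X) (by
    rw [← cancel_epi (π _ _ ▷ M.X), reassoc_of% π_act, lunitIso, ← comp_whiskerRight_assoc,
      π_πdesc, lact_act])

/-- The right unitor. -/
def runitEM (X : M.EM) : tensEM X M.unitEM ≅ X :=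
  isoEM (runitIso X) (by
    rw [← cancel_epi (π _ _ ▷ M.X), reassoc_of% π_act, runitIso, ← comp_whiskerRight_assoc,
      π_πdesc, act_act]
    rfl)

instance : MonoidalCategoryStruct M.EM where
  tensorObj := tensEM
  tensorHom f g := tensHom f g
  whiskerLeft X _ _ f := tensHom (𝟙 X) f
  whiskerRight f Y := tensHom f (𝟙 Y)
  tensorUnit := M.unitEM
  associator := assocEM
  leftUnitor := lunitEM
  rightUnitor := runitEM

/-- The quotient map `quo : A ⊗ B ⟶ X ⊗_M Y`. -/
def quot (X Y : M.EM) : X.A ⊗ Y.A ⟶ (X ⊗ Y).A := π X Y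

instance (X Y : M.EM) : Epi (quot X Y) := inferInstanceAs (Epi (π X Y))
instance (X Y : M.EM) (W : C) : Epi (quot X Y ▷ W) := inferInstanceAs (Epi (π X Y ▷ W))
instance (X Y : M.EM) (W : C) : Epi (W ◁ quot X Y) := inferInstanceAs (Epi (W ◁ π X Y))
instance (X Y : M.EM) (W Z : C) : Epi (quot X Y ▷ W ▷ Z) :=
  inferInstanceAs (Epi (π X Y ▷ W ▷ Z))

lemma quot_tensorHom {X X' Y Y' : M.EM} (f : X ⟶ X') (g : Y ⟶ Y') :
    quot X Y ≫ (f ⊗ₘ g).f = (f.f ⊗ₘ g.f) ≫ quot X' Y' := π_tensHom f g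

lemma quot_whiskerLeft (X : M.EM) {Y Y' : M.EM} (g : Y ⟶ Y') :
    quot X Y ≫ (X ◁ g).f = X.A ◁ g.f ≫ quot X Y' := by
  rw [← id_tensorHom]
  exact π_tensHom (𝟙 X) g

lemma quot_whiskerRight {X X' : M.EM} (f : X ⟶ X') (Y : M.EM) :
    quot X Y ≫ (f ▷ Y).f = f.f ▷ Y.A ≫ quot X' Y := by
  rw [← tensorHom_id]
  exact π_tensHom f (𝟙 Y)

lemma quot_associator (X Y Z : M.EM) :
    quot X Y ▷ Z.A ≫ quot (X ⊗ Y) Z ≫ (α_ X Y Z).hom.f =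
      (α_ _ _ _).hom ≫ X.A ◁ quot Y Z ≫ quot X (Y ⊗ Z) := π_assocIso X Y Z

lemma quot_leftUnitor (X : M.EM) : quot (𝟙_ M.EM) X ≫ (λ_ X).hom.f = lact X :=
  π_πdesc _ (lact_balanced X)

lemma quot_rightUnitor (X : M.EM) : quot X (𝟙_ M.EM) ≫ (ρ_ X).hom.f = act X :=
  π_πdesc _ (act_balanced X)

lemma hom_ext_tensor {X Y Z : M.EM} {f g : X ⊗ Y ⟶ Z} (h : quot X Y ≫ f.f = quot X Y ≫ g.f) :
    f = g := by
  ext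
  exact (cancel_epi (quot X Y)).1 h

lemma quot_condition (X Y : M.EM) :
    act X ▷ Y.A ≫ quot X Y = (α_ _ _ _).hom ≫ X.A ◁ lact Y ≫ quot X Y := quo_condition X Y

lemma quot_tensorHom_whisker {X X' Y Y' Z Z' : M.EM} (f : X ⟶ X') (g : Y ⟶ Y') (h : Z ⟶ Z') :
    quot X Y ▷ Z.A ≫ ((f ⊗ₘ g).f ⊗ₘ h.f) =
      ((f.f ⊗ₘ g.f) ⊗ₘ h.f) ≫ quot X' Y' ▷ Z'.A := by
  rw [← tensorHom_id, tensorHom_comp_tensorHom, quot_tensorHom, ← tensorHom_id,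
    tensorHom_comp_tensorHom, Category.id_comp, Category.comp_id]

lemma quot_whisker_tensorHom {X X' Y Y' Z Z' : M.EM} (f : X ⟶ X') (g : Y ⟶ Y') (h : Z ⟶ Z') :
    X.A ◁ quot Y Z ≫ (f.f ⊗ₘ (g ⊗ₘ h).f) =
      (f.f ⊗ₘ (g.f ⊗ₘ h.f)) ≫ X'.A ◁ quot Y' Z' := by
  rw [← id_tensorHom, tensorHom_comp_tensorHom, quot_tensorHom, ← id_tensorHom,
    tensorHom_comp_tensorHom, Category.id_comp, Category.comp_id]

/-- The monoidal category of `M`-modules under the relative tensor product. -/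
instance : MonoidalCategory M.EM where
  tensorHom_def f g := hom_ext_tensor (by
    simp [quot_tensorHom, reassoc_of% quot_whiskerRight, quot_whiskerLeft,
      MonoidalCategory.tensorHom_def])
  id_tensorHom_id X Y := hom_ext_tensor (by simp [quot_tensorHom])
  tensorHom_comp_tensorHom f g h k := hom_ext_tensor (by
    simp [quot_tensorHom, reassoc_of% quot_tensorHom])
  whiskerLeft_id X Y := hom_ext_tensor (by simp [quot_whiskerLeft])
  id_whiskerRight X Y := hom_ext_tensor (by simp [quot_whiskerRight])
  associator_naturality {X Y Z X' Y' Z'} f g h := hom_ext_tensor (by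
    rw [← cancel_epi (quot X Y ▷ Z.A)]
    simp only [Monad.Algebra.comp_f, reassoc_of% quot_tensorHom, reassoc_of% quot_associator,
      quot_tensorHom, reassoc_of% quot_tensorHom_whisker, quot_associator,
      reassoc_of% quot_whisker_tensorHom, associator_naturality_assoc])
  leftUnitor_naturality {X Y} f := hom_ext_tensor (by
    simp only [Monad.Algebra.comp_f, reassoc_of% quot_whiskerLeft, quot_leftUnitor,
      reassoc_of% quot_leftUnitor]
    exact lact_hom f)
  rightUnitor_naturality f := hom_ext_tensor (by
    simp only [Monad.Algebra.comp_f, reassoc_of% quot_whiskerRight, quot_rightUnitor,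
      reassoc_of% quot_rightUnitor]
    exact act_hom f)
  pentagon W X Y Z := hom_ext_tensor (by
    have h := congr($(quot_associator W X Y) ▷ Z.A)
    have h' := congr(W.A ◁ $(quot_associator X Y Z))
    simp only [comp_whiskerRight, whiskerLeft_comp] at h h'
    rw [← cancel_epi (quot (W ⊗ X) Y ▷ Z.A), ← cancel_epi (quot W X ▷ Y.A ▷ Z.A)]
    simp only [Monad.Algebra.comp_f, reassoc_of% quot_whiskerRight, quot_whiskerLeft,
      reassoc_of% quot_associator, reassoc_of% h]
    rw [associator_naturality_left_assoc, ← whisker_exchange_assoc, quot_associator]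
    simp [reassoc_of% h'])
  triangle X Y := hom_ext_tensor (by
    have h := congr($(quot_rightUnitor X) ▷ Y.A)
    have h' := congr(X.A ◁ $(quot_leftUnitor Y))
    simp only [comp_whiskerRight, whiskerLeft_comp] at h h'
    rw [← cancel_epi (quot X (𝟙_ _) ▷ Y.A)]
    simp only [Monad.Algebra.comp_f, reassoc_of% quot_associator, quot_whiskerLeft,
      quot_whiskerRight, reassoc_of% h, reassoc_of% h']
    exact (quot_condition X Y).symm)

/-- The forgetful functor is lax monoidal via the quotient maps. -/
instance : (forg M).LaxMonoidal where
  ε := M.one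
  μ X Y := quot X Y
  μ_natural_left f X := (quot_whiskerRight f X).symm
  μ_natural_right X f := (quot_whiskerLeft X f).symm
  associativity X Y Z := quot_associator X Y Z
  left_unitality X := by
    have h : M.one ▷ X.A ≫ quot (𝟙_ M.EM) X ≫ (λ_ X).hom.f = (λ_ X.A).hom := by
      rw [quot_leftUnitor]; exact one_lact X
    exact h.symm
  right_unitality X := by
    have h : X.A ◁ M.one ≫ quot X (𝟙_ M.EM) ≫ (ρ_ X).hom.f = (ρ_ X.A).hom := by
      rw [quot_rightUnitor]; exact one_act X
    exact h.symm

/-- The lax structure of the free functor, the factorization of `laxT` through `quo`. -/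
def frμ (A B : C) : tensEM (M.fr A) (M.fr B) ⟶ M.fr (A ⊗ B) :=
  homEM (πdesc (M.laxT A B) (laxT_balanced A B)) (by
    rw [← cancel_epi (π (M.fr A) (M.fr B) ▷ M.X), ← comp_whiskerRight_assoc, reassoc_of% π_act,
      π_πdesc, laxT_act])

lemma π_frμ (A B : C) : π (M.fr A) (M.fr B) ≫ (frμ A B).f = M.laxT A B :=
  π_πdesc _ (laxT_balanced A B)

variable (M) in
/-- The unit constraint `M ⟶ 𝟙 ⊗ M` of the free functor. -/
def frε : M.unitEM ⟶ M.fr (𝟙_ C) :=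
  homEM (λ_ M.X).inv (by
    change (λ_ M.X).inv ▷ M.X ≫ (α_ _ _ _).hom ≫ 𝟙_ C ◁ M.mul = M.mul ≫ (λ_ M.X).inv
    simp)

/-- The inverse of the lax structure of the free functor. -/
def frδ (A B : C) : M.fr (A ⊗ B) ⟶ tensEM (M.fr A) (M.fr B) :=
  (M.freeForg.homEquiv (A ⊗ B) (tensEM (M.fr A) (M.fr B))).symm
    ((M.un A ⊗ₘ M.un B) ≫ π (M.fr A) (M.fr B))

lemma frδ_f (A B : C) : (frδ (M := M) A B).f =
    ((M.un A ⊗ₘ M.un B) ≫ π (M.fr A) (M.fr B)) ▷ M.X ≫ act (tensEM (M.fr A) (M.fr B)) := by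
  rw [frδ, Adjunction.homEquiv_counit, ← freeForg_counit]
  rfl

lemma frδ_f' (A B : C) : (frδ (M := M) A B).f =
    (α_ _ _ _).hom ≫ M.un A ▷ (M.fr B).A ≫ π (M.fr A) (M.fr B) := by
  have h := congr((M.fr A).A ◁ $(M.un_act B))
  simp only [whiskerLeft_comp] at h
  rw [frδ_f, comp_whiskerRight_assoc, π_act, MonoidalCategory.tensorHom_def]
  simp only [comp_whiskerRight, Category.assoc, associator_naturality_middle_assoc, reassoc_of% h]
  rw [← associator_naturality_left_assoc]
  simp [-whiskerRight_tensor]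

lemma laxT_frδ (A B : C) : M.laxT A B ≫ (frδ A B).f = π (M.fr A) (M.fr B) := by
  have h := congr($(M.un_act A) ▷ (M.fr B).A)
  simp only [comp_whiskerRight] at h
  have h₁ : (M.fr A).A ◁ lact (M.fr B) ≫ π (M.fr A) (M.fr B) =
      (α_ _ _ _).inv ≫ act (M.fr A) ▷ (M.fr B).A ≫ π (M.fr A) (M.fr B) := by
    rw [π_condition]; simp
  rw [frδ_f', laxT_eq]
  simp only [Category.assoc, Iso.inv_hom_id_assoc]
  rw [whisker_exchange_assoc, h₁, associator_inv_naturality_left_assoc, reassoc_of% h]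
  simp

/-- The lax structure of the free functor is invertible. -/
def frμIso (A B : C) : tensEM (M.fr A) (M.fr B) ≅ M.fr (A ⊗ B) where
  hom := frμ A B
  inv := frδ A B
  hom_inv_id := by
    ext
    change (frμ A B).f ≫ (frδ A B).f = 𝟙 _
    rw [← cancel_epi (π _ _), reassoc_of% π_frμ, laxT_frδ, Category.comp_id]
  inv_hom_id := by
    ext
    change (frδ A B).f ≫ (frμ A B).f = 𝟙 _
    have h : M.un A ▷ (M.fr B).A ≫ M.laxT A B = (α_ _ _ _).inv := by
      have h' := congr(A ◁ $(one_lact (M.fr B)))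
      simp only [whiskerLeft_comp] at h'
      rw [laxT_eq, un]
      simp [reassoc_of% h', -whiskerRight_tensor]
    rw [frδ_f', Category.assoc, Category.assoc, π_frμ, h]
    simp

/-- The oplax structure on the free functor that is conjugate to the lax structure of the
forgetful functor; only used to derive the coherences of the lax structure below. -/
abbrev freeOplax : (free M).OplaxMonoidal := M.freeForg.leftAdjointOplaxMonoidal

lemma freeOplax_δ (A B : C) :
    freeOplax.δ A B = (frδ (M := M) A B : (free M).obj (A ⊗ B) ⟶ _) := by
  rw [Adjunction.leftAdjointOplaxMonoidal_δ, frδ, freeForg_unit, freeForg_unit]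
  rfl

lemma freeOplax_η : ((freeOplax (M := M)).η).f = (λ_ M.X).hom := by
  rw [Adjunction.leftAdjointOplaxMonoidal_η, Adjunction.homEquiv_counit]
  refine Eq.trans ?_ M.one_mul
  change M.one ▷ M.X ≫ (M.freeForg.counit.app M.unitEM).f = _
  rw [freeForg_counit]
  rfl

/-- The unit constraint of the free functor is invertible. -/
def frεIso : 𝟙_ M.EM ≅ (free M).obj (𝟙_ C) where
  hom := frε M
  inv := (freeOplax (M := M)).η
  hom_inv_id := by
    ext
    change (λ_ M.X).inv ≫ ((freeOplax (M := M)).η).f = _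
    rw [freeOplax_η]; exact (λ_ M.X).inv_hom_id
  inv_hom_id := by
    ext
    change ((freeOplax (M := M)).η).f ≫ (λ_ M.X).inv = _
    rw [freeOplax_η]; exact (λ_ M.X).hom_inv_id

instance : IsIso (freeOplax (M := M)).η := inferInstanceAs (IsIso (frεIso (M := M)).inv)

instance (A B : C) : IsIso ((freeOplax (M := M)).δ A B) := by
  rw [freeOplax_δ]
  exact inferInstanceAs (IsIso (frμIso (M := M) A B).inv)

lemma inv_freeOplax_η : inv (freeOplax (M := M)).η = frε M :=
  IsIso.inv_eq_of_hom_inv_id (frεIso (M := M)).inv_hom_id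

lemma inv_freeOplax_δ (A B : C) : inv ((freeOplax (M := M)).δ A B) = frμ A B :=
  IsIso.inv_eq_of_hom_inv_id (by rw [freeOplax_δ]; exact (frμIso (M := M) A B).inv_hom_id)

/-- The free functor is (strong) monoidal, with `lax` the factorization of `laxT` through `quo`. -/
instance : (free M).LaxMonoidal :=
  letI := freeOplax (M := M)
  (Functor.Monoidal.ofOplaxMonoidal (free M)).toLaxMonoidal.copy (frε M) (fun A B => frμ A B)
    inv_freeOplax_η.symm (by ext1 A; ext1 B; exact (inv_freeOplax_δ A B).symm)

lemma free_ε : Functor.LaxMonoidal.ε (free M) = frε M := rfl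

lemma free_μ (A B : C) : Functor.LaxMonoidal.μ (free M) A B = frμ A B := rfl

lemma forg_ε : Functor.LaxMonoidal.ε (forg M) = M.one := rfl

lemma forg_μ (X Y : M.EM) : Functor.LaxMonoidal.μ (forg M) X Y = quot X Y := rfl

instance : NatTrans.IsMonoidal M.freeForg.unit where
  unit := by
    rw [freeForg_unit]
    change 𝟙 _ ≫ (ρ_ (𝟙_ C)).inv ≫ 𝟙_ C ◁ M.one = M.one ≫ (λ_ M.X).inv
    simp [← unitors_inv_equal]
  tensor A B := by
    simp only [freeForg_unit]
    change 𝟙 _ ≫ M.un (A ⊗ B) = (M.un A ⊗ₘ M.un B) ≫ π (M.fr A) (M.fr B) ≫ (frμ A B).f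
    rw [π_frμ, un_laxT, Category.id_comp]

lemma laxT_π_act (X Y : M.EM) : M.laxT X.A Y.A ≫ π X Y ▷ M.X ≫ act (tensEM X Y) =
    (act X ⊗ₘ act Y) ≫ π X Y := by
  have h := congr(X.A ◁ $(lact_hom (coun Y)))
  rw [coun_f] at h
  simp only [whiskerLeft_comp] at h
  rw [π_act, laxT_eq, tensorHom_def']
  simp [π_condition, ← reassoc_of% h]

instance : NatTrans.IsMonoidal M.freeForg.counit where
  unit := by
    ext
    change ((λ_ M.X).inv ≫ M.one ▷ M.X) ≫ (M.freeForg.counit.app M.unitEM).f = 𝟙 M.X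
    rw [freeForg_counit, Category.assoc, Iso.inv_comp_eq, Category.comp_id]
    exact M.one_mul
  tensor X Y := by
    ext
    change ((frμ X.A Y.A).f ≫ π X Y ▷ M.X) ≫ (coun (tensEM X Y)).f =
      (tensHom (coun X) (coun Y)).f ≫ 𝟙 _
    rw [← cancel_epi (π (M.fr X.A) (M.fr Y.A)), Category.assoc, reassoc_of% π_frμ, coun_f,
      laxT_π_act, reassoc_of% π_tensHom, coun_f, coun_f, Category.comp_id]

end Tensor

end CommCentralMonoid

/-- A monoidal adjunction `G ⊣ R`: both functors are lax monoidal, and the unit and counit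
are monoidal transformations. -/
structure MonoidalAdjunction (C : Type u₁) [Category.{v₁} C] [MonoidalCategory C]
    (D : Type u₂) [Category.{v₂} D] [MonoidalCategory D] where
  G : C ⥤ D
  R : D ⥤ C
  [laxG : G.LaxMonoidal]
  [laxR : R.LaxMonoidal]
  adj : G ⊣ R
  [unit_isMonoidal : NatTrans.IsMonoidal adj.unit]
  [counit_isMonoidal : NatTrans.IsMonoidal adj.counit]

attribute [instance] MonoidalAdjunction.laxG MonoidalAdjunction.laxR
  MonoidalAdjunction.unit_isMonoidal MonoidalAdjunction.counit_isMonoidal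

namespace MonoidalAdjunction

open Functor.LaxMonoidal

variable {C : Type u₁} [Category.{v₁} C] [MonoidalCategory C]
  {D : Type u₂} [Category.{v₂} D] [MonoidalCategory D] (P : MonoidalAdjunction C D)

/-- The unit `A ⟶ R(G(A))` of the adjunction. -/
def η (A : C) : A ⟶ P.R.obj (P.G.obj A) := P.adj.unit.app A

/-- The left projection formula morphism. -/
def lproj (A : C) (X : D) : A ⊗ P.R.obj X ⟶ P.R.obj (P.G.obj A ⊗ X) :=
  P.η A ▷ P.R.obj X ≫ μ P.R (P.G.obj A) X

/-- The right projection formula morphism. -/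
def rproj (X : D) (A : C) : P.R.obj X ⊗ A ⟶ P.R.obj (X ⊗ P.G.obj A) :=
  P.R.obj X ◁ P.η A ≫ μ P.R X (P.G.obj A)

/-- The projection formula holds for `R`: all left and right projection formula morphisms
are invertible. -/
structure ProjectionFormula : Prop where
  left (A : C) (X : D) : IsIso (P.lproj A X)
  right (X : D) (A : C) : IsIso (P.rproj X A)

lemma η_naturality {A B : C} (f : A ⟶ B) : f ≫ P.η B = P.η A ≫ P.R.map (P.G.map f) :=
  P.adj.unit.naturality f

lemma η_counit (X : D) : P.η (P.R.obj X) ≫ P.R.map (P.adj.counit.app X) = 𝟙 _ :=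
  P.adj.right_triangle_components X

lemma η_tensor (A B : C) :
    P.η (A ⊗ B) = (P.η A ⊗ₘ P.η B) ≫ μ P.R _ _ ≫ P.R.map (μ P.G A B) := by
  have h := NatTrans.IsMonoidal.tensor (τ := P.adj.unit) A B
  refine Eq.trans ?_ h
  exact (Category.id_comp _).symm

/-- `lproj` at the unit object: `A ⊗ R(𝟙) ⟶ R(G(A))`. -/
def lp (A : C) : A ⊗ P.R.obj (𝟙_ D) ⟶ P.R.obj (P.G.obj A) :=
  P.lproj A (𝟙_ D) ≫ P.R.map (ρ_ _).hom

/-- `rproj` at the unit object: `R(𝟙) ⊗ A ⟶ R(G(A))`. -/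
def rp (A : C) : P.R.obj (𝟙_ D) ⊗ A ⟶ P.R.obj (P.G.obj A) :=
  P.rproj (𝟙_ D) A ≫ P.R.map (λ_ _).hom

/-- The multiplication of `R(𝟙)`. -/
def mulR : P.R.obj (𝟙_ D) ⊗ P.R.obj (𝟙_ D) ⟶ P.R.obj (𝟙_ D) :=
  μ P.R _ _ ≫ P.R.map (λ_ _).hom

lemma lp_naturality {A B : C} (f : A ⟶ B) :
    f ▷ P.R.obj (𝟙_ D) ≫ P.lp B = P.lp A ≫ P.R.map (P.G.map f) := by
  simp only [lp, lproj, Category.assoc]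
  rw [← comp_whiskerRight_assoc, η_naturality, comp_whiskerRight_assoc, μ_natural_left_assoc,
    ← P.R.map_comp, ← P.R.map_comp, rightUnitor_naturality]

lemma rp_naturality {A B : C} (f : A ⟶ B) :
    P.R.obj (𝟙_ D) ◁ f ≫ P.rp B = P.rp A ≫ P.R.map (P.G.map f) := by
  simp only [rp, rproj, Category.assoc]
  rw [← whiskerLeft_comp_assoc, η_naturality, whiskerLeft_comp_assoc, μ_natural_right_assoc,
    ← P.R.map_comp, ← P.R.map_comp, leftUnitor_naturality]

lemma one_lp (A : C) : A ◁ ε P.R ≫ P.lp A = (ρ_ A).hom ≫ P.η A := by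
  simp only [lp, lproj, Category.assoc]
  rw [whisker_exchange_assoc, ← right_unitality, rightUnitor_naturality]

lemma one_rp (A : C) : ε P.R ▷ A ≫ P.rp A = (λ_ A).hom ≫ P.η A := by
  simp only [rp, rproj, Category.assoc]
  rw [← whisker_exchange_assoc, ← left_unitality, leftUnitor_naturality]

lemma lp_tensor (A B : C) : P.lp (A ⊗ B) = (α_ _ _ _).hom ≫ A ◁ P.lp B ≫
    P.lproj A (P.G.obj B) ≫ P.R.map (μ P.G A B) := by
  simp only [lp, lproj, η_tensor, tensorHom_def', comp_whiskerRight, whiskerLeft_comp,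
    Category.assoc, μ_natural_left_assoc, μ_whiskerRight_comp_μ_assoc]
  rw [whisker_exchange_assoc, whisker_exchange_assoc, μ_natural_right_assoc]
  simp only [← P.R.map_comp, rightUnitor_naturality, rightUnitor_tensor_hom,
    Iso.inv_hom_id_assoc, Category.assoc]
  simp

lemma rp_tensor (A B : C) : P.rp (A ⊗ B) = (α_ _ _ _).inv ≫ P.rp A ▷ B ≫
    P.rproj (P.G.obj A) B ≫ P.R.map (μ P.G A B) := by
  simp only [rp, rproj, η_tensor, MonoidalCategory.tensorHom_def, comp_whiskerRight,
    whiskerLeft_comp, Category.assoc, μ_natural_right_assoc, whiskerLeft_μ_comp_μ_assoc]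
  rw [← whisker_exchange_assoc, ← whisker_exchange_assoc, μ_natural_left_assoc]
  simp only [← P.R.map_comp, leftUnitor_naturality, leftUnitor_tensor_hom,
    Iso.hom_inv_id_assoc, Category.assoc]
  simp

lemma rp_lproj (A B : C) : A ◁ P.rp B ≫ P.lproj A (P.G.obj B) =
    (α_ _ _ _).inv ≫ P.lp A ▷ B ≫ P.rproj (P.G.obj A) B := by
  simp only [rp, rproj, lp, lproj, comp_whiskerRight, whiskerLeft_comp, Category.assoc]
  rw [whisker_exchange_assoc (P.η A) (P.R.map _), μ_natural_right,
    whisker_exchange_assoc (P.η A) (μ P.R _ _), whiskerLeft_μ_comp_μ_assoc,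
    ← whisker_exchange_assoc (P.R.map _) (P.η B), μ_natural_left,
    ← whisker_exchange_assoc (μ P.R _ _) (P.η B), ← P.R.map_comp, triangle]
  simp only [tensor_whiskerLeft, whiskerRight_tensor, Category.assoc,
    Iso.hom_inv_id_assoc]
  rw [associator_inv_naturality_right_assoc, whisker_exchange_assoc,
    associator_inv_naturality_right_assoc, Iso.hom_inv_id_assoc]

lemma mulR_rp (A : C) : P.mulR ▷ A ≫ P.rp A = (α_ _ _ _).hom ≫ P.R.obj (𝟙_ D) ◁ P.rp A ≫
    μ P.R _ _ ≫ P.R.map (λ_ _).hom := by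
  simp only [rp, rproj, mulR, comp_whiskerRight, whiskerLeft_comp, Category.assoc]
  rw [← whisker_exchange_assoc, ← whisker_exchange_assoc, μ_natural_left_assoc,
    μ_natural_right_assoc]
  simp [-left_unitality, -right_unitality]

lemma mulR_lp (A : C) : A ◁ P.mulR ≫ P.lp A = (α_ _ _ _).inv ≫ P.lp A ▷ P.R.obj (𝟙_ D) ≫
    μ P.R _ _ ≫ P.R.map (ρ_ _).hom := by
  simp only [lp, lproj, mulR, comp_whiskerRight, whiskerLeft_comp, Category.assoc]
  rw [whisker_exchange_assoc, whisker_exchange_assoc, μ_natural_left_assoc,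
    μ_natural_right_assoc]
  simp only [whiskerRight_tensor, Category.assoc, unitors_equal]
  rw [whiskerLeft_μ_comp_μ_assoc]
  simp [-left_unitality, -right_unitality]

lemma rp_lp (A : C) : P.rp A ▷ P.R.obj (𝟙_ D) ≫ μ P.R _ _ ≫ P.R.map (ρ_ _).hom =
    (α_ _ _ _).hom ≫ P.R.obj (𝟙_ D) ◁ P.lp A ≫ μ P.R _ _ ≫ P.R.map (λ_ _).hom := by
  simp only [lp, lproj, rp, rproj, comp_whiskerRight, whiskerLeft_comp, Category.assoc]
  rw [μ_natural_left_assoc, μ_natural_right_assoc]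
  simp [-left_unitality, -right_unitality]

lemma lp_counit : P.lp (P.R.obj (𝟙_ D)) ≫ P.R.map (P.adj.counit.app (𝟙_ D)) = P.mulR := by
  simp only [lp, lproj, mulR, Category.assoc]
  rw [← P.R.map_comp, ← rightUnitor_naturality, P.R.map_comp, ← μ_natural_left_assoc,
    ← comp_whiskerRight_assoc, η_counit, unitors_equal]
  simp

lemma rp_counit : P.rp (P.R.obj (𝟙_ D)) ≫ P.R.map (P.adj.counit.app (𝟙_ D)) = P.mulR := by
  simp only [rp, rproj, mulR, Category.assoc]
  rw [← P.R.map_comp, ← leftUnitor_naturality, P.R.map_comp, ← μ_natural_right_assoc,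
    ← whiskerLeft_comp_assoc, η_counit]
  simp

/-- The half-braiding `R(𝟙) ⊗ A ≅ A ⊗ R(𝟙)`, given by `rproj` followed by the inverse of
`lproj`. -/
def halfBraiding (h : P.ProjectionFormula) : HalfBraiding (P.R.obj (𝟙_ D)) :=
  haveI := h.left
  haveI := h.right
  have hl (A : C) : IsIso (P.lp A) := inferInstanceAs (IsIso (P.lproj A (𝟙_ D) ≫ _))
  have hr (A : C) : IsIso (P.rp A) := inferInstanceAs (IsIso (P.rproj (𝟙_ D) A ≫ _))
  { β := fun A => asIso (P.rp A) ≪≫ (asIso (P.lp A)).symm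
    monoidal := fun A B => by
      have h₁ : A ◁ P.rp B ≫ A ◁ inv (P.lp B) ≫ A ◁ P.lp B = A ◁ P.rp B := by
        simp only [← whiskerLeft_comp, IsIso.inv_hom_id, Category.comp_id]
      have h₂ : P.rp A ▷ B ≫ inv (P.lp A) ▷ B ≫ P.lp A ▷ B = P.rp A ▷ B := by
        simp only [← comp_whiskerRight, IsIso.inv_hom_id, Category.comp_id]
      dsimp
      rw [← cancel_mono (P.lp (A ⊗ B)), Category.assoc, IsIso.inv_hom_id, Category.comp_id]
      simp only [comp_whiskerRight, whiskerLeft_comp, Category.assoc, lp_tensor, rp_tensor,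
        Iso.inv_hom_id_assoc, reassoc_of% h₁, reassoc_of% P.rp_lproj, Iso.hom_inv_id_assoc,
        reassoc_of% h₂]
    naturality := fun {A B} f => by
      dsimp
      rw [← cancel_mono (P.lp B)]
      simp only [Category.assoc, IsIso.inv_hom_id, Category.comp_id, lp_naturality,
        rp_naturality, IsIso.inv_hom_id_assoc] }

lemma halfBraiding_lp (h : P.ProjectionFormula) (A : C) :
    ((P.halfBraiding h).β A).hom ≫ P.lp A = P.rp A := by
  have := h.left
  have hl : IsIso (P.lp A) := inferInstanceAs (IsIso (P.lproj A (𝟙_ D) ≫ _))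
  simp [halfBraiding]

/-- If the projection formula holds, `R(𝟙)` is a commutative central monoid. -/
def centralMonoid (h : P.ProjectionFormula) : CommCentralMonoid C where
  X := P.R.obj (𝟙_ D)
  one := ε P.R
  mul := P.mulR
  one_mul := (left_unitality P.R (𝟙_ D)).symm
  mul_one := by rw [mulR, unitors_equal]; exact (right_unitality P.R (𝟙_ D)).symm
  mul_assoc := by
    simp only [mulR, comp_whiskerRight, whiskerLeft_comp, Category.assoc]
    have e : (λ_ (𝟙_ D)).hom ▷ 𝟙_ D ≫ (λ_ (𝟙_ D)).hom =
        (α_ _ _ _).hom ≫ 𝟙_ D ◁ (λ_ (𝟙_ D)).hom ≫ (λ_ (𝟙_ D)).hom := by monoidal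
    have e' := congrArg P.R.map e
    simp only [Functor.map_comp] at e'
    rw [μ_natural_left_assoc, μ_natural_right_assoc, e', ← associativity_assoc]
  halfBraiding := P.halfBraiding h
  one_swap A := by
    have := h.left
    have hl : IsIso (P.lp A) := inferInstanceAs (IsIso (P.lproj A (𝟙_ D) ≫ _))
    rw [← cancel_mono (P.lp A)]
    simp only [Category.assoc, halfBraiding_lp, one_rp, one_lp, Iso.inv_hom_id_assoc]
  mul_swap A := by
    have := h.left
    have hl : IsIso (P.lp A) := inferInstanceAs (IsIso (P.lproj A (𝟙_ D) ≫ _))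
    have h₁ : P.R.obj (𝟙_ D) ◁ ((P.halfBraiding h).β A).hom ≫ P.R.obj (𝟙_ D) ◁ P.lp A =
        P.R.obj (𝟙_ D) ◁ P.rp A := by rw [← whiskerLeft_comp, halfBraiding_lp]
    have h₂ : ((P.halfBraiding h).β A).hom ▷ P.R.obj (𝟙_ D) ≫ P.lp A ▷ P.R.obj (𝟙_ D) =
        P.rp A ▷ P.R.obj (𝟙_ D) := by rw [← comp_whiskerRight, halfBraiding_lp]
    rw [← cancel_mono (P.lp A)]
    simp only [Category.assoc, halfBraiding_lp, mulR_rp, mulR_lp, Iso.hom_inv_id_assoc,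
      reassoc_of% h₂, rp_lp, Iso.inv_hom_id_assoc, reassoc_of% h₁]
  swap_mul := by
    rw [← lp_counit, ← Category.assoc, halfBraiding_lp, rp_counit, lp_counit]

end MonoidalAdjunction

/-- Data `(U, V, α, β)` of mates between monoidal adjunctions `G ⊣ R` and `G' ⊣ R'`: lax monoidal
functors `U`, `V` and monoidal transformations `α : G'U ⟶ VG`, `β : UR ⟶ R'V` that
respect the units (equivalently, the counits). -/
structure MateDatum {C : Type u₁} [Category.{v₁} C] [MonoidalCategory C]
    {D : Type u₂} [Category.{v₂} D] [MonoidalCategory D]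
    {C' : Type u₃} [Category.{v₃} C'] [MonoidalCategory C']
    {D' : Type u₄} [Category.{v₄} D'] [MonoidalCategory D']
    (P : MonoidalAdjunction C D) (P' : MonoidalAdjunction C' D') where
  U : C ⥤ C'
  V : D ⥤ D'
  [laxU : U.LaxMonoidal]
  [laxV : V.LaxMonoidal]
  α : U ⋙ P'.G ⟶ P.G ⋙ V
  β : P.R ⋙ U ⟶ V ⋙ P'.R
  [α_isMonoidal : NatTrans.IsMonoidal α]
  [β_isMonoidal : NatTrans.IsMonoidal β]
  resp_unit (A : C) : P'.adj.unit.app (U.obj A) ≫ P'.R.map (α.app A) =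
    U.map (P.adj.unit.app A) ≫ β.app (P.G.obj A)

attribute [instance] MateDatum.laxU MateDatum.laxV MateDatum.α_isMonoidal MateDatum.β_isMonoidal

namespace MateDatum

variable {C : Type u₁} [Category.{v₁} C] [MonoidalCategory C]
  {D : Type u₂} [Category.{v₂} D] [MonoidalCategory D]
  {C' : Type u₃} [Category.{v₃} C'] [MonoidalCategory C']
  {D' : Type u₄} [Category.{v₄} D'] [MonoidalCategory D']
  {C'' : Type u₅} [Category.{v₅} C''] [MonoidalCategory C'']
  {D'' : Type u₆} [Category.{v₆} D''] [MonoidalCategory D'']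
  {P : MonoidalAdjunction C D} {P' : MonoidalAdjunction C' D'} {P'' : MonoidalAdjunction C'' D''}

/-- A transformation between mate data: monoidal transformations `τ : U₁ ⟶ U₂` and
`σ : V₁ ⟶ V₂` compatible with the `α`s and the `β`s. -/
@[ext]
structure Hom (f g : MateDatum P P') where
  τ : f.U ⟶ g.U
  σ : f.V ⟶ g.V
  τ_isMonoidal : NatTrans.IsMonoidal τ
  σ_isMonoidal : NatTrans.IsMonoidal σ
  comm_α (A : C) : P'.G.map (τ.app A) ≫ g.α.app A = f.α.app A ≫ σ.app (P.G.obj A)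
  comm_β (X : D) : τ.app (P.R.obj X) ≫ g.β.app X = f.β.app X ≫ P'.R.map (σ.app X)

attribute [instance] Hom.τ_isMonoidal Hom.σ_isMonoidal

/-- Mate data and their transformations form a category under vertical composition. -/
instance : Category (MateDatum P P') where
  Hom := Hom
  id f :=
    { τ := 𝟙 _
      σ := 𝟙 _
      τ_isMonoidal := inferInstance
      σ_isMonoidal := inferInstance
      comm_α := by simp
      comm_β := by simp }
  comp a b :=
    { τ := a.τ ≫ b.τ
      σ := a.σ ≫ b.σ
      τ_isMonoidal := inferInstance
      σ_isMonoidal := inferInstance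
      comm_α := fun A => by simp [b.comm_α, reassoc_of% a.comm_α A]
      comm_β := fun X => by simp [b.comm_β, reassoc_of% a.comm_β X] }
  id_comp a := Hom.ext (Category.id_comp _) (Category.id_comp _)
  comp_id a := Hom.ext (Category.comp_id _) (Category.comp_id _)
  assoc a b c := Hom.ext (Category.assoc _ _ _) (Category.assoc _ _ _)

variable (P) in
/-- The identity mate datum. -/
def id : MateDatum P P where
  U := 𝟭 C
  V := 𝟭 D
  α := P.G.leftUnitor.hom ≫ P.G.rightUnitor.inv
  β := P.R.rightUnitor.hom ≫ P.R.leftUnitor.inv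
  resp_unit A := by simp

/-- Composition of mate data by pasting. -/
def comp (f : MateDatum P P') (g : MateDatum P' P'') : MateDatum P P'' where
  U := f.U ⋙ g.U
  V := f.V ⋙ g.V
  α := (Functor.associator _ _ _).hom ≫ Functor.whiskerLeft f.U g.α ≫
    (Functor.associator _ _ _).inv ≫ Functor.whiskerRight f.α g.V ≫
      (Functor.associator _ _ _).hom
  β := (Functor.associator _ _ _).inv ≫ Functor.whiskerRight f.β g.U ≫
    (Functor.associator _ _ _).hom ≫ Functor.whiskerLeft f.V g.β ≫
      (Functor.associator _ _ _).inv
  resp_unit A := by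
    have h₁ := g.resp_unit (f.U.obj A)
    have h₂ := congr(g.U.map $(f.resp_unit A))
    have h₃ := g.β.naturality (f.α.app A)
    simp at h₁ h₂ h₃ ⊢
    rw [reassoc_of% h₁, ← h₃, reassoc_of% h₂]

end MateDatum

/-- Two monoidal adjunctions are equivalent if they are equivalent objects of the bicategory of
monoidal adjunctions, mate data and transformations between mate data. -/
def MonoidalAdjunction.Equivalent {C : Type u₁} [Category.{v₁} C] [MonoidalCategory C]
    {D : Type u₂} [Category.{v₂} D] [MonoidalCategory D]
    {C' : Type u₃} [Category.{v₃} C'] [MonoidalCategory C']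
    {D' : Type u₄} [Category.{v₄} D'] [MonoidalCategory D']
    (P : MonoidalAdjunction C D) (P' : MonoidalAdjunction C' D') : Prop :=
  ∃ (f : MateDatum P P') (g : MateDatum P' P),
    Nonempty (f.comp g ≅ MateDatum.id P) ∧ Nonempty (g.comp f ≅ MateDatum.id P')


/-- The monoidal Eilenberg-Moore adjunction `Free ⊣ Forg` between `C` and the category of
`M`-modules. -/
def CommCentralMonoid.emAdjunction {C : Type u₁} [Category.{v₁} C] [MonoidalCategory C]
    [HasReflexiveCoequalizers C] [TensorPreservesReflexiveCoequalizers C]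
    (M : CommCentralMonoid C) : MonoidalAdjunction C M.EM where
  G := M.free
  R := M.forg
  adj := M.freeForg

end

/-! Write `K` for the comparison functor `toEM`, sending `X` to `R(X)` with the action of `M = R(𝟙)`
coming from the lax structure. On objects `Forg ∘ K` is `R` itself, so everything reduces to showing
that `K` is an equivalence and that it is strong monoidal.

Equivalence: the reflexive-coequalizer form of Beck's theorem makes the usual comparison from `D` to
`RG`-algebras an equivalence. The left projection formula at `X = 𝟙` identifies `A ⊗ M` with
`RG(A)`, and this is an isomorphism of monads (`lpMonadIso`). Transporting along it turns the usual
comparison into `K` (`comparisonIso`).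

Monoidality: because `swap` is `rproj` followed by the inverse of `lproj`, the left action it
induces on `R(X)` is the one given by the lax structure (`lact_toEM`). Hence the lax structure of
`R` is balanced over `M` and factors through `⊗_M`, which makes `K` lax monoidal. Its unit
constraint is an identity on underlying objects. For `μ` at `(X, Y)`, take first `X = G(A)`: then
`K(G(A))` is the free module on `A`, and `lproj` factors as an epimorphism `A ⊗ R(Y) ⟶ Free(A) ⊗_M
K(Y)` followed by an isomorphism and `μ`, so `μ` is invertible (`isIso_toEMμ_obj`). A general `X` is
the reflexive coequalizer of its canonical presentation by objects `G(A)`, and `R(- ⊗ Y)` preserves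
that coequalizer, so invertibility passes to `X` (`isIso_of_isColimit_cofork`).

Finally, a strong monoidal equivalence over `C` compatible with the right adjoints is an equivalence
of monoidal adjunctions: the components `α` are mates of the `β`s, hence carry no further conditions
(`comm_α_of_comm_β`), and the inverse functor is lax monoidal by doctrinal adjunction. -/

noncomputable section

/-! ### Mates: the `β`s determine everything -/

namespace MateDatum

variable {C : Type u₁} [Category.{v₁} C] [MonoidalCategory C]
  {D : Type u₂} [Category.{v₂} D] [MonoidalCategory D]
  {C₂ : Type u₃} [Category.{v₃} C₂] [MonoidalCategory C₂]
  {D₂ : Type u₄} [Category.{v₄} D₂] [MonoidalCategory D₂]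
  {P : MonoidalAdjunction C D} {P' : MonoidalAdjunction C₂ D₂}

/-- The mate datum determined by the transformation `β` between the right adjoints. -/
def ofRight (U : C ⥤ C₂) (V : D ⥤ D₂) [U.LaxMonoidal] [V.LaxMonoidal]
    (β : P.R ⋙ U ⟶ V ⋙ P'.R) [NatTrans.IsMonoidal β] : MateDatum P P' where
  U := U
  V := V
  -- The mate `G'U ⟶ G'URG ⟶ G'R'VG ⟶ VG` of `β`; `resp_unit` is then a triangle identity for `G' ⊣
  -- R'`.
  α := Functor.whiskerRight (U.leftUnitor.inv ≫ Functor.whiskerRight P.adj.unit U ≫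
      (Functor.associator _ _ _).hom ≫ Functor.whiskerLeft P.G β ≫
        (Functor.associator _ _ _).inv) P'.G ≫
    (Functor.associator _ _ _).hom ≫ Functor.whiskerLeft (P.G ⋙ V) P'.adj.counit ≫
      (Functor.rightUnitor _).hom
  β := β
  resp_unit A := by simp

/-- The component `α` of a mate datum is determined by `β`. -/
lemma α_app_eq (f : MateDatum P P') (A : C) : f.α.app A =
    P'.G.map (f.U.map (P.adj.unit.app A) ≫ f.β.app (P.G.obj A)) ≫
      P'.adj.counit.app (f.V.obj (P.G.obj A)) := by
  rw [← f.resp_unit]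
  simp

/-- Compatibility with the `α`s follows from compatibility with the `β`s. -/
lemma comm_α_of_comm_β {f g : MateDatum P P'} (τ : f.U ⟶ g.U) (σ : f.V ⟶ g.V)
    (h : ∀ X, τ.app (P.R.obj X) ≫ g.β.app X = f.β.app X ≫ P'.R.map (σ.app X)) (A : C) :
    P'.G.map (τ.app A) ≫ g.α.app A = f.α.app A ≫ σ.app (P.G.obj A) := by
  have h₁ := τ.naturality (P.adj.unit.app A)
  -- The claim transposed along `G' ⊣ R'`: naturality of `τ` at the unit, then `h` at `G(A)`.
  have h₂ : τ.app A ≫ g.U.map (P.adj.unit.app A) ≫ g.β.app (P.G.obj A) =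
      f.U.map (P.adj.unit.app A) ≫ f.β.app (P.G.obj A) ≫ P'.R.map (σ.app (P.G.obj A)) := by
    rw [← h]
    exact (congr($h₁ ≫ g.β.app (P.G.obj A)).trans (Category.assoc _ _ _)).symm.trans
      (Category.assoc _ _ _)
  rw [α_app_eq, α_app_eq, ← P'.G.map_comp_assoc, h₂]
  simp

/-- Isomorphisms of mate data from monoidal isomorphisms compatible with the `β`s. -/
def isoMk {f g : MateDatum P P'} (τ : f.U ≅ g.U) (σ : f.V ≅ g.V)
    (hτ : NatTrans.IsMonoidal τ.hom) (hσ : NatTrans.IsMonoidal σ.hom)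
    (h : ∀ X, τ.hom.app (P.R.obj X) ≫ g.β.app X = f.β.app X ≫ P'.R.map (σ.hom.app X)) :
    f ≅ g :=
  have h' (X : D) :
      τ.inv.app (P.R.obj X) ≫ f.β.app X = g.β.app X ≫ P'.R.map (σ.inv.app X) := by
    rw [← cancel_epi (τ.hom.app (P.R.obj X)), reassoc_of% h X, ← P'.R.map_comp]
    simp
  { hom := ⟨τ.hom, σ.hom, hτ, hσ, comm_α_of_comm_β _ _ h, h⟩
    inv := ⟨τ.inv, σ.inv, inferInstance, inferInstance, comm_α_of_comm_β _ _ h', h'⟩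
    hom_inv_id := Hom.ext τ.hom_inv_id σ.hom_inv_id
    inv_hom_id := Hom.ext τ.inv_hom_id σ.inv_hom_id }

end MateDatum

/-! ### Equivalences of adjunctions over a fixed base -/

namespace MonoidalAdjunction

variable {C : Type u₁} [Category.{v₁} C] [MonoidalCategory C]
  {D : Type u₂} [Category.{v₂} D] [MonoidalCategory D]
  {D₂ : Type u₃} [Category.{v₃} D₂] [MonoidalCategory D₂]

/-- Two monoidal adjunctions over the same category are equivalent if their right adjoints
correspond to each other under a monoidal equivalence. -/
lemma equivalent_of_equivalence (P : MonoidalAdjunction C D) (P' : MonoidalAdjunction C D₂)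
    (e : D ≌ D₂) [e.functor.Monoidal] (β : P.R ≅ e.functor ⋙ P'.R)
    (hβ : NatTrans.IsMonoidal β.hom) : P.Equivalent P' := by
  -- Doctrinal adjunction: the right adjoint of a strong monoidal functor is lax monoidal, in such a
  -- way that unit and counit are monoidal.
  let : e.inverse.LaxMonoidal := e.toAdjunction.rightAdjointLaxMonoidal
  have hu : NatTrans.IsMonoidal e.unitIso.hom :=
    inferInstanceAs (NatTrans.IsMonoidal e.toAdjunction.unit)
  have hc : NatTrans.IsMonoidal e.counitIso.hom :=
    inferInstanceAs (NatTrans.IsMonoidal e.toAdjunction.counit)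
  let f : MateDatum P P' := MateDatum.ofRight (𝟭 C) e.functor (P.R.rightUnitor.hom ≫ β.hom)
  let g : MateDatum P' P := MateDatum.ofRight (𝟭 C) e.inverse
    (P'.R.rightUnitor.hom ≫ P'.R.leftUnitor.inv ≫ Functor.whiskerRight e.counitIso.inv P'.R ≫
      (Functor.associator _ _ _).hom ≫ Functor.whiskerLeft e.inverse β.inv)
  have hl : NatTrans.IsMonoidal (𝟭 C).leftUnitor.hom := inferInstance
  refine ⟨f, g, ⟨MateDatum.isoMk (𝟭 C).leftUnitor e.unitIso.symm hl
    (inferInstanceAs (NatTrans.IsMonoidal e.unitIso.inv)) fun X => ?_⟩,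
    ⟨MateDatum.isoMk (𝟭 C).leftUnitor e.counitIso hl hc fun X => ?_⟩⟩
  -- The pasted `β` contains the inverse counit at `e.functor.obj X`; a triangle identity rewrites
  -- it as the image of the unit, which cancels after moving `β.inv` past it.
  · have h := (β.inv.naturality (e.unitIso.inv.app X)).symm
    have h' : e.counitIso.inv.app (e.functor.obj X) = e.functor.map (e.unitIso.hom.app X) :=
      e.counitInv_app_functor X
    dsimp at h
    simp [f, g, MateDatum.comp, MateDatum.id, MateDatum.ofRight, h, h', ← Functor.map_comp_assoc]
  · simp [f, g, MateDatum.comp, MateDatum.id, MateDatum.ofRight]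

end MonoidalAdjunction

/-! ### The comparison functor to `R(𝟙)`-modules and its lax structure -/

namespace MonoidalAdjunction

open Functor.LaxMonoidal CommCentralMonoid

variable {C : Type u₁} [Category.{v₁} C] [MonoidalCategory C]
  {D : Type u₂} [Category.{v₂} D] [MonoidalCategory D] (P : MonoidalAdjunction C D)

/-- The right action of `R(𝟙)` on `R(X)`. -/
def actR (X : D) : P.R.obj X ⊗ P.R.obj (𝟙_ D) ⟶ P.R.obj X :=
  μ P.R X (𝟙_ D) ≫ P.R.map (ρ_ X).hom

/-- The left action of `R(𝟙)` on `R(X)`. -/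
def lactR (X : D) : P.R.obj (𝟙_ D) ⊗ P.R.obj X ⟶ P.R.obj X :=
  μ P.R (𝟙_ D) X ≫ P.R.map (λ_ X).hom

lemma one_actR (X : D) : P.R.obj X ◁ ε P.R ≫ P.actR X = (ρ_ _).hom :=
  (right_unitality P.R X).symm

lemma actR_actR (X : D) : P.actR X ▷ P.R.obj (𝟙_ D) ≫ P.actR X =
    (α_ _ _ _).hom ≫ P.R.obj X ◁ P.mulR ≫ P.actR X := by
  simp only [actR, mulR, comp_whiskerRight, whiskerLeft_comp, Category.assoc]
  have e : (ρ_ X).hom ▷ 𝟙_ D ≫ (ρ_ X).hom =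
      (α_ _ _ _).hom ≫ X ◁ (λ_ (𝟙_ D)).hom ≫ (ρ_ X).hom := by simp
  have e' := congrArg P.R.map e
  simp only [Functor.map_comp] at e'
  rw [μ_natural_left_assoc, μ_natural_right_assoc, e', ← associativity_assoc]

lemma actR_naturality {X Y : D} (f : X ⟶ Y) :
    P.R.map f ▷ P.R.obj (𝟙_ D) ≫ P.actR Y = P.actR X ≫ P.R.map f := by
  simp only [actR, Category.assoc]
  rw [μ_natural_left_assoc, ← P.R.map_comp, ← P.R.map_comp, rightUnitor_naturality]

/-- The triangle identity cancels the unit inside `lp`. Read through `lp`, the `RG`-algebra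
structure of `R(X)` is therefore its `R(𝟙)`-action. -/
lemma lp_map_counit (X : D) :
    P.lp (P.R.obj X) ≫ P.R.map (P.adj.counit.app X) = P.actR X := by
  simp only [lp, lproj, actR, Category.assoc]
  rw [← P.R.map_comp, ← rightUnitor_naturality, P.R.map_comp, ← μ_natural_left_assoc,
    ← comp_whiskerRight_assoc, η_counit]
  simp

lemma rp_map_counit (X : D) :
    P.rp (P.R.obj X) ≫ P.R.map (P.adj.counit.app X) = P.lactR X := by
  simp only [rp, rproj, lactR, Category.assoc]
  rw [← P.R.map_comp, ← leftUnitor_naturality, P.R.map_comp, ← μ_natural_right_assoc,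
    ← whiskerLeft_comp_assoc, η_counit]
  simp

/-- The triangle axiom for `X ⊗ 𝟙 ⊗ Y`, carried through the associativity of `μ`. It is the reason
why `μ` descends to the relative tensor product. -/
lemma actR_μ (X Y : D) : P.actR X ▷ P.R.obj Y ≫ μ P.R X Y =
    (α_ _ _ _).hom ≫ P.R.obj X ◁ P.lactR Y ≫ μ P.R X Y := by
  simp only [actR, lactR, comp_whiskerRight, whiskerLeft_comp, Category.assoc]
  rw [μ_natural_left, μ_natural_right, ← triangle, P.R.map_comp, associativity_assoc]

lemma μ_actR (X Y : D) : μ P.R X Y ▷ P.R.obj (𝟙_ D) ≫ P.actR (X ⊗ Y) =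
    (α_ _ _ _).hom ≫ P.R.obj X ◁ P.actR Y ≫ μ P.R X Y := by
  simp only [actR, whiskerLeft_comp, Category.assoc]
  rw [μ_natural_right, rightUnitor_tensor_hom, P.R.map_comp, associativity_assoc]

variable (h : P.ProjectionFormula)

/-- The comparison functor from `D` to the category of `R(𝟙)`-modules. -/
def toEM : D ⥤ (P.centralMonoid h).EM where
  obj X := mkEM (M := P.centralMonoid h) (P.R.obj X) (P.actR X) (P.one_actR X) (P.actR_actR X)
  map f := homEM (P.R.map f) (P.actR_naturality f)

lemma act_toEM (X : D) : act ((P.toEM h).obj X) = P.actR X := rfl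

/-- Both actions on `R(X)` are the counit after `lp` or `rp`, and the half-braiding is defined to
exchange `rp` and `lp`. -/
lemma lact_toEM (X : D) : lact ((P.toEM h).obj X) = P.lactR X := by
  change ((P.halfBraiding h).β (P.R.obj X)).hom ≫ P.actR X = _
  rw [← lp_map_counit, ← Category.assoc, halfBraiding_lp, rp_map_counit]

/-- The lax structure of `R` as a map between the underlying objects of modules. -/
def toEMLax (X Y : D) : ((P.toEM h).obj X).A ⊗ ((P.toEM h).obj Y).A ⟶
    ((P.toEM h).obj (X ⊗ Y)).A := μ P.R X Y

lemma toEMLax_balanced (X Y : D) :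
    act ((P.toEM h).obj X) ▷ ((P.toEM h).obj Y).A ≫ P.toEMLax h X Y =
      (α_ _ _ _).hom ≫ ((P.toEM h).obj X).A ◁ lact ((P.toEM h).obj Y) ≫ P.toEMLax h X Y := by
  rw [lact_toEM]
  exact P.actR_μ X Y

lemma toEMLax_act (X Y : D) :
    P.toEMLax h X Y ▷ (P.centralMonoid h).X ≫ act ((P.toEM h).obj (X ⊗ Y)) =
      (α_ _ _ _).hom ≫ ((P.toEM h).obj X).A ◁ act ((P.toEM h).obj Y) ≫ P.toEMLax h X Y :=
  P.μ_actR X Y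

lemma toEMLax_associativity (X Y Z : D) :
    P.toEMLax h X Y ▷ ((P.toEM h).obj Z).A ≫ P.toEMLax h (X ⊗ Y) Z ≫
        ((P.toEM h).map (α_ X Y Z).hom).f =
      (α_ _ _ _).hom ≫ ((P.toEM h).obj X).A ◁ P.toEMLax h Y Z ≫ P.toEMLax h X (Y ⊗ Z) :=
  associativity P.R X Y Z

/-- The unit constraint of the comparison functor, the identity on underlying objects. -/
def toEMε [HasReflexiveCoequalizers C] [TensorPreservesReflexiveCoequalizers C] :
    𝟙_ (P.centralMonoid h).EM ≅ (P.toEM h).obj (𝟙_ D) :=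
  isoEM (Iso.refl (P.R.obj (𝟙_ D))) (by
    -- The action uses the right unitor and the multiplication the left one; they agree at `𝟙`.
    change 𝟙 (P.R.obj (𝟙_ D)) ▷ P.R.obj (𝟙_ D) ≫ P.actR (𝟙_ D) = P.mulR ≫ 𝟙 _
    simp [actR, mulR, unitors_equal])

variable [HasReflexiveCoequalizers C] [TensorPreservesReflexiveCoequalizers C]

/-- The lax structure of the comparison functor, the factorization of the lax structure of `R`
through the relative tensor product. -/
def toEMμ (X Y : D) : (P.toEM h).obj X ⊗ (P.toEM h).obj Y ⟶ (P.toEM h).obj (X ⊗ Y) :=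
  homEM (X := tensEM _ _) (πdesc (P.toEMLax h X Y) (P.toEMLax_balanced h X Y)) (by
    rw [← cancel_epi (π _ _ ▷ _), ← comp_whiskerRight_assoc, reassoc_of% π_act, π_πdesc,
      toEMLax_act])

lemma quot_toEMμ (X Y : D) :
    quot ((P.toEM h).obj X) ((P.toEM h).obj Y) ≫ (P.toEMμ h X Y).f = P.toEMLax h X Y :=
  π_πdesc _ (P.toEMLax_balanced h X Y)

/-- Precomposed with the epimorphic quotient maps, each axiom becomes the corresponding one for `R`.
-/
instance : (P.toEM h).LaxMonoidal where
  ε := (P.toEMε h).hom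
  μ X Y := P.toEMμ h X Y
  μ_natural_left f X := hom_ext_tensor (by
    rw [Monad.Algebra.comp_f, Monad.Algebra.comp_f, reassoc_of% quot_whiskerRight, quot_toEMμ,
      reassoc_of% quot_toEMμ]
    exact μ_natural_left _ _ _)
  μ_natural_right X f := hom_ext_tensor (by
    rw [Monad.Algebra.comp_f, Monad.Algebra.comp_f, reassoc_of% quot_whiskerLeft, quot_toEMμ,
      reassoc_of% quot_toEMμ]
    exact μ_natural_right _ _ _)
  associativity X Y Z := hom_ext_tensor (by
    have h₁ := congr($(P.quot_toEMμ h X Y) ▷ ((P.toEM h).obj Z).A)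
    have h₂ := congr(((P.toEM h).obj X).A ◁ $(P.quot_toEMμ h Y Z))
    simp only [comp_whiskerRight, whiskerLeft_comp] at h₁ h₂
    rw [← cancel_epi (quot _ _ ▷ _)]
    simp only [Monad.Algebra.comp_f, reassoc_of% quot_whiskerRight, reassoc_of% quot_associator,
      reassoc_of% quot_whiskerLeft, quot_toEMμ, reassoc_of% quot_toEMμ, reassoc_of% h₁,
      reassoc_of% h₂]
    exact P.toEMLax_associativity h X Y Z)
  left_unitality X := hom_ext_tensor (by
    simp only [Monad.Algebra.comp_f, reassoc_of% quot_whiskerRight, quot_leftUnitor, lact_toEM,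
      reassoc_of% quot_toEMμ]
    change P.lactR X = 𝟙 (P.R.obj (𝟙_ D)) ▷ P.R.obj X ≫ P.lactR X
    simp)
  right_unitality X := hom_ext_tensor (by
    simp only [Monad.Algebra.comp_f, reassoc_of% quot_whiskerLeft, quot_rightUnitor, act_toEM,
      reassoc_of% quot_toEMμ]
    change P.actR X = P.R.obj X ◁ 𝟙 (P.R.obj (𝟙_ D)) ≫ P.actR X
    simp)

/-- The functor `R` is the composite of the comparison functor and the forgetful functor. -/
def toEMForg : P.R ≅ P.toEM h ⋙ forg (P.centralMonoid h) :=
  NatIso.ofComponents (fun X => Iso.refl (P.R.obj X))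
    (fun f => (Category.comp_id (P.R.map f)).trans (Category.id_comp (P.R.map f)).symm)

instance : NatTrans.IsMonoidal (P.toEMForg h).hom where
  unit := (Category.comp_id (ε P.R)).trans (Category.comp_id (ε P.R)).symm
  tensor X Y := by
    change μ P.R X Y ≫ 𝟙 _ = (𝟙 (P.R.obj X) ⊗ₘ 𝟙 (P.R.obj Y)) ≫
      quot ((P.toEM h).obj X) ((P.toEM h).obj Y) ≫ (P.toEMμ h X Y).f
    refine Eq.trans ?_
      (congrArg ((𝟙 (P.R.obj X) ⊗ₘ 𝟙 (P.R.obj Y)) ≫ ·) (P.quot_toEMμ h X Y)).symm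
    change _ = (𝟙 (P.R.obj X) ⊗ₘ 𝟙 (P.R.obj Y)) ≫ μ P.R X Y
    simp

end MonoidalAdjunction

/-! ### Invertibility criteria and tensoring with free modules -/

/-- A comparison from a cofork with epimorphic leg to a coequalizer is invertible if it is
invertible in the middle and epimorphic on the left. -/
lemma isIso_of_isColimit_cofork {E : Type u₁} [Category.{v₁} E] {a b x a' b' x' : E}
    {f g : a ⟶ b} {p : b ⟶ x} {f' g' : a' ⟶ b'} {p' : b' ⟶ x'} {i : a ⟶ a'} {j : b ⟶ b'}
    {k : x ⟶ x'} (hf : f ≫ j = i ≫ f') (hg : g ≫ j = i ≫ g') (hp : p ≫ k = j ≫ p')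
    (w : f ≫ p = g ≫ p) {w' : f' ≫ p' = g' ≫ p'} (hc : IsColimit (Cofork.ofπ p' w'))
    [Epi p] [Epi i] [IsIso j] : IsIso k := by
  -- The inverse of `k` will be induced by `inv j ≫ p`. That this coequalizes `f'` and `g'` can be
  -- tested on the epimorphism `i`, so the upper fork need not be a coequalizer.
  have hw : f' ≫ inv j ≫ p = g' ≫ inv j ≫ p := by
    rw [← cancel_epi i, ← reassoc_of% hf, ← reassoc_of% hg]
    simpa using w
  have hl : p' ≫ Cofork.IsColimit.desc hc (inv j ≫ p) hw = inv j ≫ p :=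
    Cofork.IsColimit.π_desc' hc _ hw
  have : Epi p' := epi_of_isColimit_cofork hc
  refine ⟨Cofork.IsColimit.desc hc (inv j ≫ p) hw, ?_, ?_⟩
  · rw [← cancel_epi p, reassoc_of% hp, hl]
    simp
  · rw [← cancel_epi p', reassoc_of% hl, hp]
    simp

/-- If `u ≫ w` is invertible and `u` is an epimorphism, then `w` is invertible. -/
lemma isIso_of_isIso_comp_of_epi {E : Type u₁} [Category.{v₁} E] {a b c : E} (u : a ⟶ b)
    (w : b ⟶ c) [Epi u] [IsIso (u ≫ w)] : IsIso w :=
  have : IsSplitMono u := ⟨⟨w ≫ inv (u ≫ w), by rw [← Category.assoc, IsIso.hom_inv_id]⟩⟩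
  have : IsIso u := isIso_of_epi_of_isSplitMono u
  IsIso.of_isIso_comp_left u w

namespace CommCentralMonoid

variable {C : Type u₁} [Category.{v₁} C] [MonoidalCategory C] {M : CommCentralMonoid C}

instance {X Y : M.EM} (f : X ⟶ Y) [IsIso f] : IsIso f.f :=
  inferInstanceAs (IsIso (M.forg.map f))

lemma isIso_of_isIso_f {X Y : M.EM} (f : X ⟶ Y) [hf : IsIso f.f] : IsIso f := by
  have : IsIso (M.forg.map f) := hf
  exact isIso_of_reflects_iso f M.forg

/-- The map `A ⊗ Y ⟶ (A ⊗ M) ⊗_M Y` induced by the unit of `M` is an epimorphism. -/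
lemma epi_un_quot [HasReflexiveCoequalizers C] [TensorPreservesReflexiveCoequalizers C]
    (A : C) (Y : M.EM) : Epi (M.un A ▷ Y.A ≫ quot (M.fr A) Y) := by
  have h := congr($(M.un_act A) ▷ Y.A)
  simp only [comp_whiskerRight] at h
  have h₁ : (M.fr A).A ◁ lact Y ≫ quot (M.fr A) Y =
      (α_ _ _ _).inv ≫ act (M.fr A) ▷ Y.A ≫ quot (M.fr A) Y := by
    rw [quot_condition]; simp
  -- Over `M`, the factor `M` of `A ⊗ M` can be moved onto `Y`, leaving the unit behind; so the
  -- quotient map, an epimorphism, factors through the map in question.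
  have e : ((α_ _ _ _).hom ≫ A ◁ lact Y) ≫ M.un A ▷ Y.A ≫ quot (M.fr A) Y =
      quot (M.fr A) Y := by
    rw [Category.assoc, whisker_exchange_assoc, h₁, associator_inv_naturality_left_assoc,
      reassoc_of% h]
    simp
  exact epi_of_epi_fac e

end CommCentralMonoid

/-! ### Free modules `K(G(A))`, the monad `RG`, and `μ` at `G(A)` -/

namespace MonoidalAdjunction

open Functor.LaxMonoidal CommCentralMonoid

variable {C : Type u₁} [Category.{v₁} C] [MonoidalCategory C]
  {D : Type u₂} [Category.{v₂} D] [MonoidalCategory D] (P : MonoidalAdjunction C D)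
  (h : P.ProjectionFormula)

/-- If the projection formula holds, the comparison map `A ⊗ R(𝟙) ⟶ R(G(A))` is invertible. -/
def lpIso (A : C) : A ⊗ P.R.obj (𝟙_ D) ≅ P.R.obj (P.G.obj A) :=
  have := h.left
  asIso (P.lproj A (𝟙_ D)) ≪≫ P.R.mapIso (ρ_ _)

lemma un_lp (A : C) : (P.centralMonoid h).un A ≫ P.lp A = P.η A := by
  change ((ρ_ A).inv ≫ A ◁ ε P.R) ≫ P.lp A = _
  simp [one_lp]

/-- The comparison map `A ⊗ R(𝟙) ⟶ R(G(A))` as a morphism of modules. -/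
def lpEM (A : C) : (P.centralMonoid h).fr A ⟶ (P.toEM h).obj (P.G.obj A) :=
  homEM (P.lp A) (by
    change P.lp A ▷ P.R.obj (𝟙_ D) ≫ P.actR (P.G.obj A) =
      ((α_ _ _ _).hom ≫ A ◁ P.mulR) ≫ P.lp A
    simp [mulR_lp, actR])

/-- By the projection formula, the comparison functor takes `G(A)` to the free module on `A`. -/
instance (A : C) : IsIso (P.lpEM h A) := by
  have : IsIso (P.lpEM h A).f := inferInstanceAs (IsIso (P.lpIso h A).hom)
  exact isIso_of_isIso_f _

/-- Naturality of the counit at its own component; this is the fork obtained by applying `R(- ⊗ Y)`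
to the canonical presentation of `X`. -/
lemma counit_whiskerRight_condition (X Y : D) :
    P.R.map (P.G.map (P.R.map (P.adj.counit.app X)) ▷ Y) ≫ P.R.map (P.adj.counit.app X ▷ Y) =
      P.R.map (P.adj.counit.app (P.G.obj (P.R.obj X)) ▷ Y) ≫
        P.R.map (P.adj.counit.app X ▷ Y) := by
  have e := P.adj.counit_naturality (P.adj.counit.app X)
  simp only [← P.R.map_comp, ← comp_whiskerRight]
  exact congr(P.R.map ($e ▷ Y))

/-- The monad `(-) ⊗ R(𝟙)` is isomorphic to the monad `RG`. -/
def lpMonadIso : (P.centralMonoid h).monad ≅ P.adj.toMonad :=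
  MonadIso.mk (NatIso.ofComponents (P.lpIso h) (fun f => P.lp_naturality f))
    (fun A => P.un_lp h A)
    (fun A => by
      -- By `lp_map_counit` the last two factors form the action on `R(G(A))`, so compatibility with
      -- the multiplications is linearity of `lp`.
      change ((α_ _ _ _).hom ≫ A ◁ P.mulR) ≫ P.lp A = (P.lp A ▷ P.R.obj (𝟙_ D) ≫
        P.lp (P.R.obj (P.G.obj A))) ≫ P.R.map (P.adj.counit.app (P.G.obj A))
      rw [Category.assoc, Category.assoc, lp_map_counit]
      simp [mulR_lp, actR])

/-- The comparison functor to `R(𝟙)`-modules corresponds to the comparison functor to algebras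
of the monad `RG`. -/
def comparisonIso : Monad.comparison P.adj ⋙
    Monad.algebraFunctorOfMonadHom (P.lpMonadIso h).hom ≅ P.toEM h :=
  NatIso.ofComponents
    (fun X => isoEM (Iso.refl (P.R.obj X)) (by
      change 𝟙 (P.R.obj X) ▷ P.R.obj (𝟙_ D) ≫ P.actR X =
        (P.lp (P.R.obj X) ≫ P.R.map (P.adj.counit.app X)) ≫ 𝟙 (P.R.obj X)
      simp [lp_map_counit]))
    (fun f => by
      ext
      exact (Category.comp_id (P.R.map f)).trans (Category.id_comp (P.R.map f)).symm)

section

variable [HasReflexiveCoequalizers C] [TensorPreservesReflexiveCoequalizers C]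

/-- `lproj` is `η` followed by `μ`, and `η` is the unit of the free module followed by `lp`; hence
`lproj` passes through the relative tensor product with the free module. -/
lemma un_quot_lpEM_toEMμ (A : C) (Y : D) :
    ((P.centralMonoid h).un A ▷ ((P.toEM h).obj Y).A ≫
      quot ((P.centralMonoid h).fr A) ((P.toEM h).obj Y)) ≫
        (P.lpEM h A ▷ (P.toEM h).obj Y ≫ P.toEMμ h (P.G.obj A) Y).f = P.lproj A Y := by
  rw [Monad.Algebra.comp_f, Category.assoc, reassoc_of% quot_whiskerRight, quot_toEMμ,
    ← comp_whiskerRight_assoc]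
  exact congr($(P.un_lp h A) ▷ P.R.obj Y ≫ μ P.R (P.G.obj A) Y)

/-- In the factorization of the invertible `lproj`, the first map is an epimorphism, so the rest is
invertible, and `lpEM` can be cancelled from it. -/
lemma isIso_toEMμ_obj (A : C) (Y : D) : IsIso (P.toEMμ h (P.G.obj A) Y) := by
  have he := epi_un_quot (M := P.centralMonoid h) A ((P.toEM h).obj Y)
  have hi := h.left A Y
  rw [← P.un_quot_lpEM_toEMμ h] at hi
  have : IsIso (P.lpEM h A ▷ (P.toEM h).obj Y ≫ P.toEMμ h _ Y).f :=
    @isIso_of_isIso_comp_of_epi _ _ _ _ _ _ _ he hi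
  have := isIso_of_isIso_f (P.lpEM h A ▷ (P.toEM h).obj Y ≫ P.toEMμ h _ Y)
  exact IsIso.of_isIso_comp_left (P.lpEM h A ▷ (P.toEM h).obj Y) _

lemma toEMμ_natural_left {X X' : D} (f : X ⟶ X') (Y : D) :
    ((P.toEM h).map f ▷ (P.toEM h).obj Y).f ≫ (P.toEMμ h X' Y).f =
      (P.toEMμ h X Y).f ≫ P.R.map (f ▷ Y) :=
  congrArg Monad.Algebra.Hom.f (μ_natural_left (P.toEM h) f Y)

/-- In `C` the unit splits `R` of the counit; split epimorphisms survive whiskering, and the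
quotient maps are epimorphisms. -/
lemma epi_toEM_counit_whiskerRight (X Y : D) :
    Epi ((P.toEM h).map (P.adj.counit.app X) ▷ (P.toEM h).obj Y).f := by
  have : IsSplitEpi ((P.toEM h).map (P.adj.counit.app X)).f :=
    ⟨⟨P.η (P.R.obj X), P.η_counit X⟩⟩
  have : IsSplitEpi (((P.toEM h).map (P.adj.counit.app X)).f ▷ ((P.toEM h).obj Y).A) :=
    inferInstanceAs (IsSplitEpi ((tensorRight ((P.toEM h).obj Y).A).map _))
  have e := quot_whiskerRight ((P.toEM h).map (P.adj.counit.app X)) ((P.toEM h).obj Y)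
  have : Epi (quot _ _ ≫ ((P.toEM h).map (P.adj.counit.app X) ▷ (P.toEM h).obj Y).f) := by
    rw [e]
    infer_instance
  exact epi_of_epi (quot _ _) _

end

end MonoidalAdjunction

/-! ### Monadicity and strong monoidality of the comparison functor -/

namespace MonoidalAdjunction

open Functor.LaxMonoidal CommCentralMonoid Monad.MonadicityInternal

variable {C : Type u₁} [Category.{v₁} C] [MonoidalCategory C]
  {D : Type u₂} [Category.{v₁} D] [MonoidalCategory D] (P : MonoidalAdjunction C D)
  [HasReflexiveCoequalizers D] [Monad.PreservesColimitOfIsReflexivePair P.R]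
  [P.R.ReflectsIsomorphisms]

/-- Every object of `D` is the coequalizer of its canonical presentation by objects `G(A)`. -/
def counitIsColimit (X : D) : IsColimit (counitCofork P.adj X) :=
  -- The pair is reflexive, so `R` preserves its coequalizer and, reflecting isomorphisms, also
  -- reflects it; the image of the fork under `R` is Beck's split coequalizer.
  have : ReflectsColimit (parallelPair (P.G.map (P.R.map (P.adj.counit.app X)))
      (P.adj.counit.app (P.G.obj (P.R.obj X)))) P.R :=
    reflectsColimit_of_reflectsIsomorphisms _ _
  counitCoequalizerOfReflectsCoequalizer P.adj X

/-- The crude monadicity theorem. -/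
lemma isEquivalence_comparison : (Monad.comparison P.adj).IsEquivalence :=
  (Monad.monadicOfHasPreservesReflexiveCoequalizersOfReflectsIsomorphisms P.adj).eqv

variable (h : P.ProjectionFormula)

instance : (P.toEM h).IsEquivalence := by
  have := P.isEquivalence_comparison
  have : (Monad.algebraFunctorOfMonadHom (P.lpMonadIso h).hom).IsEquivalence :=
    (Monad.algebraEquivOfIsoMonads (P.lpMonadIso h)).isEquivalence_inverse
  exact Functor.isEquivalence_of_iso (P.comparisonIso h)

variable [TensorPreservesReflexiveCoequalizers D]

/-- The canonical presentation of `X` is preserved by `R(- ⊗ Y)`. -/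
def counitWhiskerRightIsColimit (X Y : D) :
    IsColimit (Cofork.ofπ (P.R.map (P.adj.counit.app X ▷ Y))
      (P.counit_whiskerRight_condition X Y)) :=
  have := TensorPreservesReflexiveCoequalizers.right Y
  have : IsReflexivePair
      ((tensorRight Y).map (P.G.map (P.R.map (P.adj.counit.app X))))
      ((tensorRight Y).map (P.adj.counit.app (P.G.obj (P.R.obj X)))) :=
    -- The common section is `G` of the unit at `R(X)`, tensored with `Y`; the two triangle
    -- identities show that it is one.
    IsReflexivePair.mk' ((tensorRight Y).map (P.G.map (P.adj.unit.app (P.R.obj X))))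
      (by simp only [← Functor.map_comp]; simp) (by simp only [← Functor.map_comp]; simp)
  have : PreservesColimit (parallelPair
      ((tensorRight Y).map (P.G.map (P.R.map (P.adj.counit.app X))))
      ((tensorRight Y).map (P.adj.counit.app (P.G.obj (P.R.obj X))))) P.R := inferInstance
  isColimitCoforkMapOfIsColimit (f := (tensorRight Y).map _) (g := (tensorRight Y).map _)
    (h := (tensorRight Y).map _) P.R _
    (isColimitCoforkMapOfIsColimit (tensorRight Y) _ (P.counitIsColimit X))

variable [HasReflexiveCoequalizers C] [TensorPreservesReflexiveCoequalizers C]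

/-- `μ` compares the canonical presentation of `X` after `K(-) ⊗_M K(Y)` with the one after `R(- ⊗
Y)`. The latter is a coequalizer, the former a fork with epimorphic leg, and at the two objects of
the form `G(A)` the comparison is already invertible. -/
instance (X Y : D) : IsIso (P.toEMμ h X Y) := by
  have (A : C) : IsIso (P.toEMμ h (P.G.obj A) Y).f := by
    have := P.isIso_toEMμ_obj h A Y
    infer_instance
  have e := congr(((P.toEM h).map $(P.adj.counit_naturality (P.adj.counit.app X)) ▷
    (P.toEM h).obj Y).f)
  simp only [Functor.map_comp, comp_whiskerRight, Monad.Algebra.comp_f] at e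
  have := P.epi_toEM_counit_whiskerRight h X Y
  have : IsIso (P.toEMμ h X Y).f :=
    isIso_of_isColimit_cofork
      (P.toEMμ_natural_left h (P.G.map (P.R.map (P.adj.counit.app X))) Y)
      (P.toEMμ_natural_left h (P.adj.counit.app (P.G.obj (P.R.obj X))) Y)
      (P.toEMμ_natural_left h (P.adj.counit.app X) Y)
      e (P.counitWhiskerRightIsColimit X Y)
  exact isIso_of_isIso_f _

/-- The comparison functor is strong monoidal. -/
@[reducible]
def toEMMonoidal : (P.toEM h).Monoidal :=
  have : IsIso (ε (P.toEM h)) := inferInstanceAs (IsIso (P.toEMε h).hom)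
  have (X Y : D) : IsIso (μ (P.toEM h) X Y) := inferInstanceAs (IsIso (P.toEMμ h X Y))
  Functor.Monoidal.ofLaxMonoidal (P.toEM h)

end MonoidalAdjunction

end

theorem mainTheorem4 {C : Type u₁} [Category.{v₁} C] [MonoidalCategory C]
    {D : Type u₂} [Category.{v₁} D] [MonoidalCategory D]
    [HasReflexiveCoequalizers C] [TensorPreservesReflexiveCoequalizers C]
    [HasReflexiveCoequalizers D] [TensorPreservesReflexiveCoequalizers D]
    (P : MonoidalAdjunction C D)
    (hR : Monad.PreservesColimitOfIsReflexivePair P.R)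
    (hiso : P.R.ReflectsIsomorphisms)
    (hproj : P.ProjectionFormula) :
    P.Equivalent (P.centralMonoid hproj).emAdjunction ∧
      (Monad.comparison P.adj).IsEquivalence := by
  have hβ : NatTrans.IsMonoidal (P.toEMForg hproj).hom := inferInstance
  -- This strong structure extends the lax structure for which `hβ` was found, so `hβ` applies
  -- unchanged.
  let : (P.toEM hproj).asEquivalence.functor.Monoidal := P.toEMMonoidal hproj
  exact ⟨P.equivalent_of_equivalence (P.centralMonoid hproj).emAdjunction
    (P.toEM hproj).asEquivalence (P.toEMForg hproj) hβ, P.isEquivalence_comparison⟩
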